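/- Let $\mathfrak g$ be a finite-dimensional complex semisimple Lie algebra with adjoint group $G$, let $\{e,h,f\}\subset\mathfrak g$ be an $\mathfrak{sl}_2$-triple (with $h\neq 0$), and let $\chi=\kappa(e)\in\mathfrak g^*$, where $\kappa:\mathfrak g\to\mathfrak g^*$ is the isomorphism given by the Killing form. Put $\mathfrak g(i)=\{x\in\mathfrak g : [h,x]=ix\}$, let $\ell\subset\mathfrak g(-1)$ be a Lagrangian subspace for the form $(x,y)\mapsto\chi([x,y])$, let $\mathfrak m=\ell\oplus\bigoplus_{i\le -2}\mathfrak g(i)$, and let $M\subset G$ be the unipotent subgroup with Lie algebra $\mathfrak m$, which is generated by the elements $\exp(\operatorname{ad}x)$, $x\in\mathfrak m$. Let $\mathcal B$ be the flag variety of all Borel subalgebras of $\mathfrak g$, viewed as a complex submanifold of the Grassmannian of $\mathfrak g$, and let $$T^*\mathcal B=\{(\lambda,\mathfrak b)\in\mathfrak g^*\times\mathcal B : \lambda|_{\mathfrak b}=0\},\qquad p(\lambda,\mathfrak b)=\mathfrak b,$$ be its cotangent bundle with its standard symplectic form (the exterior derivative of the Liouville $1$-form, where $T_{\mathfrak b}\mathcal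 B=\mathfrak g/\mathfrak b$). Let $\mathfrak m^\perp\subset\mathfrak g^*$ be the annihilator of $\mathfrak m$, put $\Sigma=\{(\lambda,\mathfrak b)\in T^*\mathcal B : \lambda\in\chi+\mathfrak m^\perp\}$ and let $\sigma=p|_\Sigma:\Sigma\to\mathcal B$. (i) For every Borel subalgebra $\mathfrak b$ of $\mathfrak g$: $\mathfrak b\in\sigma(\Sigma)$ if and only if $\chi|_{\mathfrak m\cap\mathfrak b}=0$. (ii) For every $M$-orbit $X\subset\sigma(\Sigma)$, the set $X$ is a submanifold of $\mathcal B$ and $\sigma^{-1}(X)\to X$ is a twisted conormal bundle on $X$. That is, $\sigma^{-1}(X)\subset p^{-1}(X)$ is a Lagrangian submanifold of $T^*\mathcal B$, and $\sigma$ makes $\sigma^{-1}(X)\to X$ an affine bundle: its fibres are affine subspaces of the fibres of $p$, and locally on $X$ it has holomorphic trivializations that are affine on the fibres. -/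

import Mathlib

open scoped Topology
open Module

noncomputable section

namespace SlodowyConormal

/-! ### Complex submanifolds of a complex vector space -/

/-- `S` is a (locally closed, embedded) complex submanifold of dimension `k` of the complex normed
space `E`: around each of its points there is a biholomorphic change of coordinates that turns
`S` into a `k`-dimensional linear subspace. -/
def IsComplexSubmanifold {E : Type*} [NormedAddCommGroup E] [NormedSpace ℂ E]
    (k : ℕ) (S : Set E) : Prop :=
  ∀ x ∈ S, ∃ φ : OpenPartialHomeomorph E E, x ∈ φ.source ∧
    AnalyticOnNhd ℂ φ φ.source ∧ AnalyticOnNhd ℂ φ.symm φ.target ∧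
    ∃ K : Submodule ℂ E, finrank ℂ K = k ∧ ∀ y ∈ φ.source, y ∈ S ↔ φ y ∈ K

section Grassmannian

variable {V : Type*} [AddCommGroup V] [Module ℂ V] {d m : ℕ}

/-! ### The standard holomorphic charts of the Grassmannian and of `V* × Gr(V)`

A basis `e = (e₁, …, e_d, f₁, …, f_m)` of `V` gives the standard affine chart
`A ↦ span {e_i + ∑ j, A i j • f_j}` of the Grassmannian of `d`-dimensional subspaces of `V`. It
parametrizes the open set of all complements of `span {f_j}`. These charts, for all bases, form
the standard holomorphic atlas, and each subspace is the origin of one of them. -/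

/-- The space of matrices that parametrizes a standard chart of the Grassmannian. -/
abbrev GrCoord (d m : ℕ) : Type := Fin d → Fin m → ℂ

/-- The `i`-th vector `e_i + ∑ j, A i j • f_j` of the frame with matrix `A`. -/
def grFrame (e : Basis (Fin d ⊕ Fin m) ℂ V) (A : GrCoord d m) (i : Fin d) : V :=
  e (Sum.inl i) + ∑ j, A i j • e (Sum.inr j)

/-- The standard chart of the Grassmannian attached to a basis (as a parametrization). -/
def grChart (e : Basis (Fin d ⊕ Fin m) ℂ V) (A : GrCoord d m) : Submodule ℂ V :=
  Submodule.span ℂ (Set.range (grFrame e A))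

/-- Coordinates on `V* × Gr(V)`: the values of the covector on the basis, and the matrix. -/
abbrev PairCoord (d m : ℕ) : Type := (Fin d ⊕ Fin m → ℂ) × GrCoord d m

/-- The chart of `V* × Gr(V)` attached to a basis of `V`: the covector takes the prescribed values
on the basis vectors, and the subspace has the prescribed matrix. -/
def pairChart (e : Basis (Fin d ⊕ Fin m) ℂ V) (p : PairCoord d m) :
    Dual ℂ V × Submodule ℂ V :=
  (e.constr ℂ p.1, grChart e p.2)

/-- `X` is a complex submanifold of dimension `k` of the Grassmannian. -/
def IsGrSubmanifold (k : ℕ) (X : Set (Submodule ℂ V)) : Prop :=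
  ∀ (d m : ℕ) (e : Basis (Fin d ⊕ Fin m) ℂ V), IsComplexSubmanifold k (grChart e ⁻¹' X)

end Grassmannian

variable {𝔤 : Type*} [LieRing 𝔤] [LieAlgebra ℂ 𝔤]

/-! ### The flag variety and its cotangent bundle -/

/-- A Borel subalgebra is a maximal solvable subalgebra. -/
def IsBorel (b : LieSubalgebra ℂ 𝔤) : Prop :=
  Maximal (fun c : LieSubalgebra ℂ 𝔤 => LieAlgebra.IsSolvable c) b

variable (𝔤) in
/-- The flag variety `ℬ`: the set of all Borel subalgebras, inside the Grassmannian of `𝔤`. -/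
def flagVariety : Set (Submodule ℂ 𝔤) :=
  {W | ∃ b : LieSubalgebra ℂ 𝔤, IsBorel b ∧ b.toSubmodule = W}

variable (𝔤) in
/-- The cotangent bundle `T*ℬ = {(l, b) | b ∈ ℬ, l ∈ b^⊥}`, inside `𝔤* × Gr(𝔤)`. -/
def cotangentFlag : Set (Dual ℂ 𝔤 × Submodule ℂ 𝔤) :=
  {y | y.2 ∈ flagVariety 𝔤 ∧ ∀ x ∈ y.2, y.1 x = 0}

/-! ### The canonical symplectic structure of `T*ℬ` -/

section Liouville

variable {d m : ℕ}

/-- The element `a : 𝔤` generates the tangent vector `A'` of the Grassmannian at the point `W` with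
matrix `A`. In other words, both the infinitesimal motion `w ↦ ⁅a, w⁆` of `W` and the motion
`A'` give the same element of `T_W Gr = Hom(W, 𝔤/W)`. Under the identification `T_b ℬ = 𝔤/b`,
the vector `A'` tangent to `ℬ` is then the class of `a`. -/
def Generates (e : Basis (Fin d ⊕ Fin m) ℂ 𝔤) (A A' : GrCoord d m) (a : 𝔤) : Prop :=
  ∀ i, ⁅a, grFrame e A i⁆ - ∑ j, A' i j • e (Sum.inr j) ∈ grChart e A

open scoped Classical in
/-- The Liouville (tautological) 1-form of `T*ℬ`, at the point with coordinates `p = (l, b)`, on the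
tangent vector with coordinates `p'`: the value of `l ∈ b^⊥ = (𝔤/b)*` on the image
of `p'` in `T_b ℬ = 𝔤/b`. -/
def liouvilleForm (e : Basis (Fin d ⊕ Fin m) ℂ 𝔤) (p p' : PairCoord d m) : ℂ :=
  if h : ∃ a, Generates e p.2 p'.2 a then (pairChart e p).1 h.choose else 0

/-- A Borel subalgebra is its own normalizer. -/
theorem IsBorel.mem_of_normalizes {b : LieSubalgebra ℂ 𝔤} (hb : IsBorel b) {z : 𝔤}
    (hz : ∀ y ∈ b, ⁅z, y⁆ ∈ b) : z ∈ b := by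
  have hzn : z ∈ b.normalizer := (b.mem_normalizer_iff z).2 hz
  let K : LieSubalgebra ℂ 𝔤 :=
    { (Submodule.span ℂ {z} ⊔ b.toSubmodule) with
      lie_mem' := fun {_ _} => LieSubalgebra.lie_mem_sup_of_mem_normalizer hzn }
  have hbK : b ≤ K := fun y hy => (Submodule.mem_sup_right hy : y ∈ Submodule.span ℂ {z} ⊔ b.toSubmodule)
  have hzK : z ∈ K :=
    (Submodule.mem_sup_left (Submodule.mem_span_singleton_self z) :
      z ∈ Submodule.span ℂ {z} ⊔ b.toSubmodule)
  have hcomm : ∀ u ∈ K, ∀ v ∈ K, ⁅u, v⁆ ∈ b := by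
    intro u hu v hv
    obtain ⟨u1, hu1, u2, hu2, rfl⟩ := Submodule.mem_sup.1 hu
    obtain ⟨v1, hv1, v2, hv2, rfl⟩ := Submodule.mem_sup.1 hv
    obtain ⟨s, rfl⟩ := Submodule.mem_span_singleton.1 hu1
    obtain ⟨t, rfl⟩ := Submodule.mem_span_singleton.1 hv1
    have h1 : ⁅u2, z⁆ ∈ b := (b.mem_normalizer_iff' z).1 hzn u2 hu2
    simp only [smul_lie, add_lie, lie_add, smul_zero, lie_smul, lie_self, zero_add]
    exact b.add_mem (b.smul_mem t h1) (b.add_mem (b.smul_mem s (hz v2 hv2)) (b.lie_mem hu2 hv2))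
  let I : LieIdeal ℂ K :=
    { (b.toSubmodule.comap K.toSubmodule.subtype) with
      lie_mem := fun {x y} _ => hcomm x.1 x.2 y.1 y.2 }
  have hbs : LieAlgebra.IsSolvable b := hb.prop
  let g : I →ₗ⁅ℂ⁆ b :=
    { toFun := fun x => ⟨x.1.1, x.2⟩
      map_add' := fun _ _ => rfl
      map_smul' := fun _ _ => rfl
      map_lie' := rfl }
  have hI : LieAlgebra.IsSolvable I := by
    refine Function.Injective.lieAlgebra_isSolvable (f := g) ?_
    intro x y hxy
    exact Subtype.ext (Subtype.ext (congrArg (fun w : b => (w : 𝔤)) hxy))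
  obtain ⟨k, hk⟩ := (LieAlgebra.isSolvable_iff (R := ℂ) (L := I)).1 hI
  have hK : LieAlgebra.IsSolvable K := by
    refine LieAlgebra.IsSolvable.mk (R := ℂ) (k := k + 1) ?_
    rw [LieAlgebra.derivedSeries_def, LieAlgebra.derivedSeriesOfIdeal_add, eq_bot_iff]
    have h1 : LieAlgebra.derivedSeriesOfIdeal ℂ K 1 ⊤ ≤ I := by
      rw [LieAlgebra.derivedSeriesOfIdeal_succ, LieAlgebra.derivedSeriesOfIdeal_zero,
        LieSubmodule.lie_le_iff]
      exact fun x _ y _ => hcomm x.1 x.2 y.1 y.2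
    refine (LieAlgebra.derivedSeriesOfIdeal_mono h1 k).trans ?_
    exact le_of_eq ((LieIdeal.derivedSeries_eq_bot_iff I k).1 hk)
  exact hb.le_of_ge hK hbK hzK

/-- The Liouville form does not depend on the choice of a representative in `𝔤/b`. -/
theorem liouvilleForm_eq (e : Basis (Fin d ⊕ Fin m) ℂ 𝔤) (p p' : PairCoord d m)
    (hp : pairChart e p ∈ cotangentFlag 𝔤) {a : 𝔤} (ha : Generates e p.2 p'.2 a) :
    liouvilleForm e p p' = (pairChart e p).1 a := by
  obtain ⟨⟨b, hb, hbp⟩, hl⟩ := hp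
  have h : ∃ a, Generates e p.2 p'.2 a := ⟨a, ha⟩
  rw [liouvilleForm, dif_pos h, ← sub_eq_zero, ← map_sub]
  refine hl _ ?_
  have hbp' : b.toSubmodule = grChart e p.2 := hbp
  have key : ∀ y ∈ grChart e p.2, ⁅h.choose - a, y⁆ ∈ grChart e p.2 := by
    intro y hy
    induction hy using Submodule.span_induction with
    | mem y hy =>
      obtain ⟨i, rfl⟩ := hy
      have := Submodule.sub_mem _ (h.choose_spec i) (ha i)
      rwa [sub_sub_sub_cancel_right, ← sub_lie] at this
    | zero => simp
    | add u v _ _ hu hv => rw [lie_add]; exact Submodule.add_mem _ hu hv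
    | smul c u _ hu => rw [lie_smul]; exact Submodule.smul_mem _ c hu
  change _ ∈ grChart e p.2
  rw [← hbp']
  rw [← hbp'] at key
  exact hb.mem_of_normalizes key

end Liouville

/-- A subset `L` of `T*ℬ` is isotropic: the symplectic form `ω = dθ` vanishes on `L`, where `θ` is the
Liouville form. Concretely, for any germ of a holomorphic map `F(s, t)` from `ℂ²` to `L`,
the pull-back `F^*θ` is holomorphic, and
`(F^*ω)(∂_s, ∂_t) = ∂_s (θ (∂_t F)) - ∂_t (θ (∂_s F))` is zero. -/
def IsIsotropic (L : Set (Dual ℂ 𝔤 × Submodule ℂ 𝔤)) : Prop :=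
  ∀ (d m : ℕ) (e : Basis (Fin d ⊕ Fin m) ℂ 𝔤) (F : ℂ × ℂ → PairCoord d m),
    AnalyticAt ℂ F 0 → (∀ᶠ u in 𝓝 0, pairChart e (F u) ∈ L) →
    ∃ P Q : ℂ × ℂ →L[ℂ] ℂ,
      HasFDerivAt (fun u => liouvilleForm e (F u) (fderiv ℂ F u (1, 0))) P 0 ∧
      HasFDerivAt (fun u => liouvilleForm e (F u) (fderiv ℂ F u (0, 1))) Q 0 ∧
      Q (1, 0) - P (0, 1) = 0

/-- `L` is a Lagrangian submanifold of `T*ℬ`: an isotropic submanifold of half the dimension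
of `T*ℬ`. In a chart with `d × m` matrices, `m = dim (𝔤/b) = dim ℬ` is half of `dim T*ℬ`. -/
def IsLagrangian (L : Set (Dual ℂ 𝔤 × Submodule ℂ 𝔤)) : Prop :=
  L ⊆ cotangentFlag 𝔤 ∧
  (∀ (d m : ℕ) (e : Basis (Fin d ⊕ Fin m) ℂ 𝔤), IsComplexSubmanifold m (pairChart e ⁻¹' L)) ∧
  IsIsotropic L

/-- For `L ⊆ T*ℬ` lying over `X ⊆ ℬ`, the projection `L → X`, `(l, b) ↦ b`, is a holomorphic affine bundle of rank `r`: locally on `X`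
there is a holomorphic trivialization
`(b, c) ↦ (l₀ b + ∑ i, c i • l_i b, b)` of it, with `l_1 b, …, l_r b` linearly independent, so that
the trivialization is affine and bijective on fibres. A map from an open set of the
Grassmannian to `𝔤*` is holomorphic if its values at each `x : 𝔤` are. -/
def IsAffineBundle (r : ℕ) (L : Set (Dual ℂ 𝔤 × Submodule ℂ 𝔤)) (X : Set (Submodule ℂ 𝔤)) : Prop :=
  ∀ (d m : ℕ) (e : Basis (Fin d ⊕ Fin m) ℂ 𝔤) (A₀ : GrCoord d m), grChart e A₀ ∈ X →
    ∃ U ∈ 𝓝 A₀, ∃ (l₀ : GrCoord d m → Dual ℂ 𝔤) (l : Fin r → GrCoord d m → Dual ℂ 𝔤),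
      (∀ x, AnalyticOnNhd ℂ (fun A => l₀ A x) U) ∧
      (∀ i x, AnalyticOnNhd ℂ (fun A => l i A x) U) ∧
      ∀ A ∈ U, grChart e A ∈ X →
        LinearIndependent ℂ (fun i => l i A) ∧
        ∀ z : Dual ℂ 𝔤, (z, grChart e A) ∈ L ↔ ∃ c : Fin r → ℂ, z = l₀ A + ∑ i, c i • l i A

/-- `L` is a twisted conormal bundle on the submanifold `X` of `ℬ`: it lies over `X`, is a Lagrangian
submanifold of `T*ℬ`, and the bundle projection makes `L → X` an affine bundle. -/
def IsTwistedConormalBundle (L : Set (Dual ℂ 𝔤 × Submodule ℂ 𝔤)) (X : Set (Submodule ℂ 𝔤)) : Prop :=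
  (X ⊆ flagVariety 𝔤 ∧ ∃ k, IsGrSubmanifold k X) ∧
  (∀ y ∈ L, y.2 ∈ X) ∧
  IsLagrangian L ∧
  ∃ r, IsAffineBundle r L X

/-! ### The data attached to an `𝔰𝔩₂`-triple -/

/-- The weight space `𝔤(i) = {x | ⁅h, x⁆ = i x}`. -/
def weightSpace (h : 𝔤) (i : ℤ) : Submodule ℂ 𝔤 :=
  Module.End.eigenspace (LieAlgebra.ad ℂ 𝔤 h) (i : ℂ)

/-- The linear function `χ = κ(e)`, for the isomorphism `κ` given by the Killing form. -/
def chi (e : 𝔤) : Dual ℂ 𝔤 := killingForm ℂ 𝔤 e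

/-- `ℓ` is a Lagrangian subspace of `𝔤(-1)` for the form `(x, y) ↦ χ(⁅x, y⁆)`: it equals its own
orthogonal complement in `𝔤(-1)`. -/
def IsLagrangianSubspace (h e : 𝔤) (ℓ : Submodule ℂ 𝔤) : Prop :=
  ℓ ≤ weightSpace h (-1) ∧
  ∀ x ∈ weightSpace h (-1), x ∈ ℓ ↔ ∀ y ∈ ℓ, chi e ⁅x, y⁆ = 0

/-- The subspace `𝔪 = ℓ ⊕ ⨁_{i ≤ -2} 𝔤(i)`. -/
def mAlg (h : 𝔤) (ℓ : Submodule ℂ 𝔤) : Submodule ℂ 𝔤 :=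
  ℓ ⊔ ⨆ i : {i : ℤ // i ≤ -2}, weightSpace h i

/-- The exponential `exp (ad x)`, a finite sum, of an ad-nilpotent element `x`. -/
def expAd (x : 𝔤) : Module.End ℂ 𝔤 :=
  ∑ n ∈ Finset.range (nilpotencyClass (LieAlgebra.ad ℂ 𝔤 x)),
    ((n.factorial : ℂ)⁻¹) • (LieAlgebra.ad ℂ 𝔤 x) ^ n

/-- The unipotent subgroup with Lie algebra `𝔫`, for a subalgebra `𝔫` of ad-nilpotent elements: the
group of automorphisms of `𝔤` generated by all `exp (ad x)` with `x ∈ 𝔫`. -/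
def unipotentGroup (𝔫 : Submodule ℂ 𝔤) : Subgroup (𝔤 ≃ₗ[ℂ] 𝔤) :=
  Subgroup.closure {φ | ∃ x ∈ 𝔫, IsNilpotent (LieAlgebra.ad ℂ 𝔤 x) ∧
    (φ : 𝔤 →ₗ[ℂ] 𝔤) = expAd x}

/-- `X` is an orbit of the group `M` of linear automorphisms in the flag variety. -/
def IsFlagOrbit (M : Subgroup (𝔤 ≃ₗ[ℂ] 𝔤)) (X : Set (Submodule ℂ 𝔤)) : Prop :=
  ∃ W ∈ flagVariety 𝔤, X = {W' | ∃ φ ∈ M, W' = W.map (φ : 𝔤 →ₗ[ℂ] 𝔤)}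

/-- `Σ = π⁻¹(χ + 𝔪^⊥)`, where `π : T*ℬ → 𝔤*` is `(l, b) ↦ l`. -/
def sigmaVariety (h e : 𝔤) (ℓ : Submodule ℂ 𝔤) : Set (Dual ℂ 𝔤 × Submodule ℂ 𝔤) :=
  {y | y ∈ cotangentFlag 𝔤 ∧ ∃ μ : Dual ℂ 𝔤, (∀ x ∈ mAlg h ℓ, μ x = 0) ∧ y.1 = chi e + μ}

/-- The image `σ(Σ)` of `Σ` under the projection `(l, b) ↦ b` to `ℬ`. -/
def sigmaImage (h e : 𝔤) (ℓ : Submodule ℂ 𝔤) : Set (Submodule ℂ 𝔤) :=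
  Prod.snd '' sigmaVariety h e ℓ

/-- The preimage `σ⁻¹(X) ⊆ Σ`. -/
def sigmaPreimage (h e : 𝔤) (ℓ : Submodule ℂ 𝔤) (X : Set (Submodule ℂ 𝔤)) :
    Set (Dual ℂ 𝔤 × Submodule ℂ 𝔤) :=
  {y | y ∈ sigmaVariety h e ℓ ∧ y.2 ∈ X}

end SlodowyConormal

end

/-! Part (i) is linear algebra: since `(𝔪 ∩ 𝔟)^⊥ = 𝔪^⊥ + 𝔟^⊥`, a functional that vanishes on `𝔟` and
agrees with `χ` on `𝔪` exists exactly when `χ` vanishes on `𝔪 ∩ 𝔟` (`exists_extension_iff`).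

For (ii), the fibre over `W ∈ X` is a translate of `(W + 𝔪)^⊥`. Because `ℓ` is isotropic, `χ` is a
character of the subalgebra `𝔪`, so `M` fixes `χ|_𝔪` and carries fibres to fibres: over a local
section of the orbit map the bundle is a product. Borel subalgebras normalize themselves, so the
stabilizer of `W` in `𝔪` is `𝔪 ∩ W`, and the dimensions of the orbit and of the fibre add up to `dim
𝔤/𝔟` (`IsSlice.card_add_finrank`). A tangent vector of the orbit is generated by some `a ∈ 𝔪`, where
the Liouville form takes the value `χ a`. This is the pull-back of a right-invariant 1-form on the
group, for which `IsPrimitive` carries an explicit primitive; hence the Liouville form is exact on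
the bundle and the bundle is isotropic.

The main work is to show that orbits are embedded and have analytic sections. In a basis adapted to
`ad h` and ordered by weight, `M` is unitriangular, and so is its action on Plücker coordinates.
These coordinates are added in order of increasing weight. On the orbit each new one is either free,
being shifted by a one-parameter group that fixes the earlier ones, or a function of the earlier
ones. This gives a section of the whole orbit (`exists_isOrbitSection`). Read in a chart of the
Grassmannian (`exists_isSlice`), it makes the orbit, and then the bundle over it, the fixed point
set of a local retraction, hence a submanifold (`exists_submanifold_chart`). -/

noncomputable section

set_option linter.unusedSectionVars false

namespace SlodowyConormal

/-! ### Submanifolds as fixed point sets of local retractions -/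

section Retraction

variable {E Z : Type*} [NormedAddCommGroup E] [NormedSpace ℂ E] [CompleteSpace E]
  [NormedAddCommGroup Z] [NormedSpace ℂ Z]

/-- An analytic map whose derivative at a point is the identity is a local biholomorphism, and the
domain may be taken inside any given neighbourhood. -/
theorem exists_biholomorphism {φ : E → E} {x₀ : E} (hφ : AnalyticAt ℂ φ x₀)
    (hd : fderiv ℂ φ x₀ = ContinuousLinearMap.id ℂ E) {N : Set E} (hN : N ∈ 𝓝 x₀) :
    ∃ Φ : OpenPartialHomeomorph E E, x₀ ∈ Φ.source ∧ Φ.source ⊆ N ∧ (Φ : E → E) = φ ∧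
      AnalyticOnNhd ℂ Φ Φ.source ∧ AnalyticOnNhd ℂ Φ.symm Φ.target := by
  have hs : HasStrictFDerivAt φ ((ContinuousLinearEquiv.refl ℂ E : E ≃L[ℂ] E) : E →L[ℂ] E) x₀ := by
    have := hφ.hasStrictFDerivAt
    rwa [hd] at this
  let Φ₀ := hs.toOpenPartialHomeomorph φ
  have hΦ₀ : (Φ₀ : E → E) = φ := hs.toOpenPartialHomeomorph_coe
  have hinv : ∀ᶠ y in 𝓝 x₀, fderiv ℂ φ y ∈
      Set.range ((↑) : (E ≃L[ℂ] E) → E →L[ℂ] E) := by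
    have hc : ContinuousAt (fderiv ℂ φ) x₀ := hφ.fderiv.continuousAt
    refine hc.eventually ?_
    rw [hd]
    exact ContinuousLinearEquiv.nhds (ContinuousLinearEquiv.refl ℂ E)
  obtain ⟨U, hU, hUo, hxU⟩ := eventually_nhds_iff.1
    (hφ.eventually_analyticAt.and (hinv.and (Filter.eventually_of_mem hN fun y hy => hy)))
  refine ⟨Φ₀.restrOpen U hUo, ?_, ?_, ?_, ?_, ?_⟩
  · exact ⟨hs.mem_toOpenPartialHomeomorph_source, hxU⟩
  · exact fun y hy => (hU y hy.2).2.2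
  · exact hΦ₀
  · intro y hy
    have : AnalyticAt ℂ φ y := (hU y hy.2).1
    rwa [← hΦ₀] at this
  · intro z hz
    have hy := (Φ₀.restrOpen U hUo).map_target hz
    obtain ⟨i, hi⟩ := (hU _ hy.2).2.1
    refine OpenPartialHomeomorph.analyticAt_symm (i := i) _ hz ?_ ?_
    · have := (hU _ hy.2).1
      rwa [← hΦ₀] at this
    · rw [hi, ← hΦ₀]; rfl

/-- A set which near `x₀` is the fixed point set of the composition of a map `ζ : E → Z` with a local section
`Ψ` of it is a submanifold of dimension `dim Z` near `x₀`. -/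
theorem exists_submanifold_chart {S : Set E} {x₀ : E} {ζ : E → Z} {Ψ : Z → E}
    (hζ : AnalyticAt ℂ ζ x₀) (hΨ : AnalyticAt ℂ Ψ (ζ x₀)) (hx₀ : Ψ (ζ x₀) = x₀)
    {k : ℕ} (hk : finrank ℂ Z = k)
    (hsec : ∀ᶠ z in 𝓝 (ζ x₀), ζ (Ψ z) = z) (hS : ∀ᶠ x in 𝓝 x₀, x ∈ S ↔ Ψ (ζ x) = x) :
    ∃ φ : OpenPartialHomeomorph E E, x₀ ∈ φ.source ∧
      AnalyticOnNhd ℂ φ φ.source ∧ AnalyticOnNhd ℂ φ.symm φ.target ∧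
      ∃ K : Submodule ℂ E, finrank ℂ K = k ∧ ∀ y ∈ φ.source, y ∈ S ↔ φ y ∈ K := by
  set z₀ := ζ x₀ with hz₀
  set A := fderiv ℂ ζ x₀ with hA
  set B := fderiv ℂ Ψ z₀ with hB
  have hζd : HasFDerivAt ζ A x₀ := hζ.differentiableAt.hasFDerivAt
  have hΨd : HasFDerivAt Ψ B z₀ := hΨ.differentiableAt.hasFDerivAt
  have hAB : A.comp B = ContinuousLinearMap.id ℂ Z := by
    have h1 : HasFDerivAt (ζ ∘ Ψ) (A.comp B) z₀ := by
      refine HasFDerivAt.comp z₀ ?_ hΨd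
      rwa [hx₀]
    have h2 : HasFDerivAt (ζ ∘ Ψ) (ContinuousLinearMap.id ℂ Z) z₀ :=
      (hasFDerivAt_id z₀).congr_of_eventuallyEq (hsec.mono fun z hz => hz)
    exact h1.unique h2
  have hABz : ∀ z, A (B z) = z := fun z => congrArg (fun T : Z →L[ℂ] Z => T z) hAB
  -- On `S` only the last term survives, and it lies in the range of `B`. It also cancels the defect
  -- in the derivative: `1 - BA + BA = 1`.
  let φ : E → E := fun x => x - Ψ (ζ x) + B (ζ x - z₀)
  have hφ : AnalyticAt ℂ φ x₀ := by
    refine (analyticAt_id.sub (hΨ.comp hζ)).add ?_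
    exact (B.analyticAt _).comp (hζ.sub analyticAt_const)
  have hφd : fderiv ℂ φ x₀ = ContinuousLinearMap.id ℂ E := by
    have h1 : HasFDerivAt φ (ContinuousLinearMap.id ℂ E - B.comp A + B.comp A) x₀ := by
      refine ((hasFDerivAt_id x₀).sub (HasFDerivAt.comp x₀ hΨd hζd)).add ?_
      exact B.hasFDerivAt.comp x₀ (hζd.sub_const z₀)
    rw [h1.fderiv]; simp
  have hφ₀ : φ x₀ = 0 := by simp [φ, hx₀, ← hz₀]
  -- the map `x ↦ Ψ (z₀ + A (φ x))` stays near `x₀`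
  have hcont : Filter.Tendsto (fun x => z₀ + A (φ x)) (𝓝 x₀) (𝓝 z₀) := by
    have : ContinuousAt (fun x => z₀ + A (φ x)) x₀ :=
      continuousAt_const.add (A.continuous.continuousAt.comp hφ.continuousAt)
    simpa [ContinuousAt, hφ₀] using this
  have hcontΨ : Filter.Tendsto Ψ (𝓝 z₀) (𝓝 x₀) := by
    have := hΨ.continuousAt
    rwa [ContinuousAt, hx₀] at this
  -- Two nested domains are needed: `φ` is injective on the source of `Φ₁`, and on the smaller one
  -- the comparison point `Ψ (z₀ + A (φ x))` still lies in that source.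
  obtain ⟨Φ₁, hx₁, hsub₁, hΦ₁, -, -⟩ := exists_biholomorphism hφ hφd hS
  have hsrc₁ : Φ₁.source ∈ 𝓝 x₀ := Φ₁.open_source.mem_nhds hx₁
  have hev : ∀ᶠ x in 𝓝 x₀, ζ (Ψ (z₀ + A (φ x))) = z₀ + A (φ x) ∧
      Ψ (z₀ + A (φ x)) ∈ Φ₁.source :=
    (hcont.eventually hsec).and (hcont.eventually (hcontΨ.eventually hsrc₁))
  obtain ⟨Φ, hx, hsub, hΦ, h1, h2⟩ := exists_biholomorphism hφ hφd
    (Filter.inter_mem hsrc₁ hev)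
  refine ⟨Φ, hx, h1, h2, B.toLinearMap.range, ?_, ?_⟩
  · refine (LinearMap.finrank_range_of_inj ?_).trans hk
    exact Function.LeftInverse.injective (g := A) hABz
  · intro y hy
    have hyS := hsub₁ (hsub hy).1
    rw [hΦ]
    constructor
    · intro h
      refine ⟨ζ y - z₀, ?_⟩
      simp [φ, hyS.1 h]
    · rintro ⟨v, hv⟩
      have hv' : B v = φ y := hv
      obtain ⟨h3, h4⟩ := (hsub hy).2
      have hAv : A (φ y) = v := by rw [← hv', hABz]
      rw [hAv] at h3 h4
      -- `Ψ (z₀ + v)` is a fixed point of `Ψ ∘ ζ` with the same image under `φ` as `y`, so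
      -- injectivity identifies the two.
      have h5 : φ (Ψ (z₀ + v)) = φ y := by
        simp [φ, h3]
        simp [φ] at hv'
        rw [hv']
      have h6 : Ψ (z₀ + v) = y := by
        refine Φ₁.injOn h4 (hsub hy).1 ?_
        rw [hΦ₁, h5]
      exact hyS.2 (by rw [← h6, h3])

end Retraction

/-! ### Plücker coordinates -/

section Plucker

variable {V : Type*} [AddCommGroup V] [Module ℂ V] {d m : ℕ}

/-- The value of `w₁ ∧ ⋯ ∧ w_d` on `ξ₁, …, ξ_d`. -/
def wedgePairing (ξ : Fin d → Dual ℂ V) (w : Fin d → V) : ℂ :=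
  Matrix.det (Matrix.of fun a b => ξ a (w b))

/-- The Plücker coordinates of a family of vectors with respect to a basis. -/
def plucker {ι : Type*} (β : Basis ι ℂ V) (w : Fin d → V) (I : Fin d → ι) : ℂ :=
  wedgePairing (fun a => β.coord (I a)) w

/-- Expand every `ξ a` in the dual basis and use multilinearity of the determinant in its rows. The
sum runs over all multi-indices, repeated and unordered ones included, which avoids signs and
orderings. -/
theorem wedgePairing_eq_sum {ι : Type*} [Fintype ι] (β : Basis ι ℂ V)
    (ξ : Fin d → Dual ℂ V) (w : Fin d → V) :
    wedgePairing ξ w = ∑ I : Fin d → ι, (∏ a, ξ a (β (I a))) * plucker β w I := by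
  classical
  have h1 : (Matrix.of fun a b => ξ a (w b)) =
      fun a => ∑ i, ξ a (β i) • (fun b => β.coord i (w b)) := by
    ext a b
    simp only [Matrix.of_apply, Finset.sum_apply, Pi.smul_apply, smul_eq_mul, Basis.coord_apply]
    conv_lhs => rw [← β.sum_repr (w b), map_sum]
    exact Finset.sum_congr rfl fun i _ => by rw [map_smul, smul_eq_mul, mul_comm]
  have h2 := MultilinearMap.map_sum
    (Matrix.detRowAlternating (R := ℂ) (n := Fin d)).toMultilinearMap
    (fun a (i : ι) => ξ a (β i) • (fun b => β.coord i (w b)))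
  unfold wedgePairing
  rw [h1]
  refine h2.trans (Finset.sum_congr rfl fun I _ => ?_)
  exact MultilinearMap.map_smul_univ
    (Matrix.detRowAlternating (R := ℂ) (n := Fin d)).toMultilinearMap
    (fun a => ξ a (β (I a))) (fun a b => β.coord (I a) (w b))

/-- The factor is the determinant of the matrix expressing `w` in terms of `w'`, so it is the same
for all `ξ`. -/
theorem exists_wedgePairing_eq_mul {w w' : Fin d → V}
    (h : ∀ b, w b ∈ Submodule.span ℂ (Set.range w')) :
    ∃ c : ℂ, ∀ ξ : Fin d → Dual ℂ V, wedgePairing ξ w = c * wedgePairing ξ w' := by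
  have h1 : ∀ b, ∃ c : Fin d → ℂ, ∑ i, c i • w' i = w b := fun b =>
    (Submodule.mem_span_range_iff_exists_fun ℂ).1 (h b)
  choose C hC using h1
  refine ⟨Matrix.det (Matrix.of fun i b => C b i), fun ξ => ?_⟩
  unfold wedgePairing
  rw [mul_comm, ← Matrix.det_mul]
  congr 1
  ext a b
  simp [Matrix.mul_apply, ← hC b, mul_comm]

theorem exists_dual_family {w : Fin d → V} (hw : LinearIndependent ℂ w) :
    ∃ ξ : Fin d → Dual ℂ V, ∀ a b, ξ a (w b) = if a = b then 1 else 0 := by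
  classical
  obtain ⟨g, hg⟩ := LinearMap.exists_leftInverse_of_injective (Fintype.linearCombination ℂ w)
    (LinearMap.ker_eq_bot.2 (linearIndependent_iff_injective_fintypeLinearCombination.1 hw))
  refine ⟨fun a => (LinearMap.proj a).comp g, fun a b => ?_⟩
  have := LinearMap.congr_fun hg (Pi.single b 1)
  simp only [LinearMap.comp_apply, Fintype.linearCombination_apply_single, one_smul] at this
  simp [this, Pi.single_apply]

/-- Injectivity of the Plücker embedding. If some `w' b` were outside the span of `w`, take `η`
vanishing on that span but not at `w' b`, and put it in place of the `b`-th member of a family dual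
to `w'`: the pairing is then zero on `w` and nonzero on `w'`. -/
theorem span_eq_of_wedgePairing_eq_mul {w w' : Fin d → V} (hw : LinearIndependent ℂ w)
    (hw' : LinearIndependent ℂ w') {c : ℂ}
    (h : ∀ ξ : Fin d → Dual ℂ V, wedgePairing ξ w = c * wedgePairing ξ w') (hc : c ≠ 0) :
    Submodule.span ℂ (Set.range w) = Submodule.span ℂ (Set.range w') := by
  classical
  have hle : Submodule.span ℂ (Set.range w') ≤ Submodule.span ℂ (Set.range w) := by
    rw [Submodule.span_le]
    rintro _ ⟨b, rfl⟩
    by_contra hb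
    obtain ⟨η, hη, hηw⟩ := Submodule.exists_le_ker_of_notMem hb
    obtain ⟨ξ, hξ⟩ := exists_dual_family hw'
    have h0 : wedgePairing (Function.update ξ b η) w = 0 := by
      refine Matrix.det_eq_zero_of_row_eq_zero b fun a => ?_
      simpa using hηw (Submodule.subset_span ⟨a, rfl⟩)
    have h1 : wedgePairing (Function.update ξ b η) w' = η (w' b) := by
      unfold wedgePairing
      have : (Matrix.of fun a c => (Function.update ξ b η) a (w' c)) =
          (Matrix.updateCol (1 : Matrix (Fin d) (Fin d) ℂ) b (fun c => η (w' c))).transpose := by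
        ext a c
        by_cases hab : a = b
        · subst hab; simp
        · simp [hab, hξ, Matrix.one_apply, eq_comm]
      rw [this, Matrix.det_transpose, ← Matrix.cramer_apply, Matrix.cramer_one]
      rfl
    have := h (Function.update ξ b η)
    rw [h0, h1] at this
    exact hη (by simpa [hc] using this.symm)
  have := Module.Finite.span_of_finite ℂ (Set.finite_range w)
  refine (Submodule.eq_of_le_of_finrank_eq hle ?_).symm
  rw [finrank_span_eq_card hw, finrank_span_eq_card hw']

theorem exists_plucker_ne_zero {ι : Type*} [Fintype ι] (β : Basis ι ℂ V) {w : Fin d → V}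
    (hw : LinearIndependent ℂ w) : ∃ I, plucker β w I ≠ 0 := by
  classical
  by_contra! h
  obtain ⟨ξ, hξ⟩ := exists_dual_family hw
  have h1 : wedgePairing ξ w = 1 := by
    unfold wedgePairing
    rw [← Matrix.det_one (n := Fin d)]
    congr 1
    ext a b
    simp [hξ, Matrix.one_apply]
  rw [wedgePairing_eq_sum β] at h1
  simp [h] at h1

theorem grFrame_coord_inl (e : Basis (Fin d ⊕ Fin m) ℂ V) (A : GrCoord d m) (a b : Fin d) :
    e.coord (Sum.inl a) (grFrame e A b) = if a = b then 1 else 0 := by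
  classical
  simp [grFrame, Finsupp.single_apply, eq_comm]

theorem grFrame_coord_inr (e : Basis (Fin d ⊕ Fin m) ℂ V) (A : GrCoord d m) (j : Fin m)
    (b : Fin d) : e.coord (Sum.inr j) (grFrame e A b) = A b j := by
  classical
  simp [grFrame, Finsupp.single_apply]

theorem linearIndependent_grFrame (e : Basis (Fin d ⊕ Fin m) ℂ V) (A : GrCoord d m) :
    LinearIndependent ℂ (grFrame e A) := by
  classical
  rw [Fintype.linearIndependent_iff]
  intro c hc i
  have := congrArg (e.coord (Sum.inl i)) hc
  simpa only [map_sum, map_smul, grFrame_coord_inl, smul_eq_mul, mul_ite, mul_one, mul_zero,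
    Finset.sum_ite_eq, Finset.mem_univ, if_true, map_zero] using this

theorem plucker_grFrame_inl (e : Basis (Fin d ⊕ Fin m) ℂ V) (A : GrCoord d m) :
    plucker e (grFrame e A) Sum.inl = 1 := by
  unfold plucker wedgePairing
  rw [← Matrix.det_one (n := Fin d)]
  congr 1
  ext a b
  rw [Matrix.of_apply, grFrame_coord_inl, Matrix.one_apply]

/-- The minor is that of an identity matrix with one column replaced, so each chart coordinate is
itself a Plücker coordinate. -/
theorem plucker_grFrame_update (e : Basis (Fin d ⊕ Fin m) ℂ V) (A : GrCoord d m) (i : Fin d)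
    (j : Fin m) : plucker e (grFrame e A) (Function.update Sum.inl i (Sum.inr j)) = A i j := by
  unfold plucker wedgePairing
  have : (Matrix.of fun a b => e.coord (Function.update Sum.inl i (Sum.inr j) a) (grFrame e A b)) =
      (Matrix.updateCol (1 : Matrix (Fin d) (Fin d) ℂ) i (fun b => A b j)).transpose := by
    ext a b
    by_cases hab : a = i
    · subst hab
      simp only [Matrix.of_apply, Function.update_self, grFrame_coord_inr, Matrix.transpose_apply,
        Matrix.updateCol_self]
    · simp only [Matrix.of_apply, Function.update_of_ne hab, grFrame_coord_inl,
        Matrix.transpose_apply, Matrix.updateCol_ne hab, Matrix.one_apply, eq_comm]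
  rw [this, Matrix.det_transpose, ← Matrix.cramer_apply, Matrix.cramer_one]
  rfl

theorem finrank_grChart (e : Basis (Fin d ⊕ Fin m) ℂ V) (A : GrCoord d m) :
    finrank ℂ (grChart e A) = d := by
  rw [grChart, finrank_span_eq_card (linearIndependent_grFrame e A), Fintype.card_fin]

theorem grChart_injective (e : Basis (Fin d ⊕ Fin m) ℂ V) :
    Function.Injective (grChart e) := by
  intro A A' h
  obtain ⟨c, hc⟩ := exists_wedgePairing_eq_mul (w := grFrame e A) (w' := grFrame e A') fun b => by
    change _ ∈ grChart e A'
    rw [← h]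
    exact Submodule.subset_span ⟨b, rfl⟩
  have h1 : plucker e (grFrame e A) Sum.inl = c * plucker e (grFrame e A') Sum.inl := hc _
  rw [plucker_grFrame_inl, plucker_grFrame_inl, mul_one] at h1
  ext i j
  rw [← plucker_grFrame_update e A, ← plucker_grFrame_update e A', plucker, hc, ← h1, one_mul,
    plucker]

/-- The matrix of the span of `w` in the standard chart, by Cramer's rule. -/
def grMatrix (e : Basis (Fin d ⊕ Fin m) ℂ V) (w : Fin d → V) : GrCoord d m :=
  fun i j => plucker e w (Function.update Sum.inl i (Sum.inr j)) / plucker e w Sum.inl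

/-- Dividing `w` by its leading minor `C` gives a frame of the standard form. Ratios of Plücker
coordinates do not see this change of frame, and on a standard frame they are the matrix entries. -/
theorem grChart_grMatrix (e : Basis (Fin d ⊕ Fin m) ℂ V) {w : Fin d → V}
    (hΔ : plucker e w Sum.inl ≠ 0) :
    grChart e (grMatrix e w) = Submodule.span ℂ (Set.range w) := by
  classical
  set C : Matrix (Fin d) (Fin d) ℂ :=
    Matrix.of fun a b => e.coord (Sum.inl a) (w b) with hC
  have hdet : IsUnit C.det := isUnit_iff_ne_zero.2 hΔ
  let w' : Fin d → V := fun i => ∑ b, C⁻¹ b i • w b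
  let A : GrCoord d m := fun i j => e.coord (Sum.inr j) (w' i)
  have hw' : grFrame e A = w' := by
    funext i
    refine e.ext_elem fun s => ?_
    rw [← Basis.coord_apply, ← Basis.coord_apply]
    rcases s with a | j
    · rw [grFrame_coord_inl]
      have := congrFun (congrFun (Matrix.mul_nonsing_inv C hdet) a) i
      rw [Matrix.mul_apply, Matrix.one_apply] at this
      simp only [w', map_sum, map_smul, smul_eq_mul]
      rw [← this]
      exact Finset.sum_congr rfl fun b _ => by rw [hC, Matrix.of_apply, mul_comm]
    · rw [grFrame_coord_inr]
  have hle : grChart e A ≤ Submodule.span ℂ (Set.range w) := by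
    rw [grChart, hw', Submodule.span_le]
    rintro _ ⟨i, rfl⟩
    exact Submodule.sum_mem _ fun b _ => Submodule.smul_mem _ _ (Submodule.subset_span ⟨b, rfl⟩)
  have := Module.Finite.span_of_finite ℂ (Set.finite_range w)
  have heq : grChart e A = Submodule.span ℂ (Set.range w) := by
    refine Submodule.eq_of_le_of_finrank_le hle ?_
    rw [finrank_grChart]
    exact (finrank_range_le_card (R := ℂ) w).trans (by simp)
  obtain ⟨c, hc⟩ := exists_wedgePairing_eq_mul (w := w) (w' := grFrame e A) fun b => by
    change _ ∈ grChart e A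
    rw [heq]
    exact Submodule.subset_span ⟨b, rfl⟩
  have h1 : plucker e w Sum.inl = c := by
    rw [plucker, hc, ← plucker, plucker_grFrame_inl, mul_one]
  have h2 : grMatrix e w = A := by
    ext i j
    rw [grMatrix, h1, plucker, hc, ← plucker, plucker_grFrame_update, mul_div_cancel_left₀]
    rwa [← h1]
  rw [h2, heq]

theorem grMatrix_grFrame (e : Basis (Fin d ⊕ Fin m) ℂ V) (A : GrCoord d m) :
    grMatrix e (grFrame e A) = A := by
  ext i j
  rw [grMatrix, plucker_grFrame_inl, plucker_grFrame_update, div_one]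

end Plucker

theorem analyticAt_wedgePairing {V X : Type*} [NormedAddCommGroup V] [NormedSpace ℂ V]
    [FiniteDimensional ℂ V] [NormedAddCommGroup X] [NormedSpace ℂ X] {d : ℕ}
    (ξ : Fin d → Dual ℂ V) {w : X → Fin d → V} {x : X} (hw : ∀ b, AnalyticAt ℂ (fun x => w x b) x) :
    AnalyticAt ℂ (fun x => wedgePairing ξ (w x)) x := by
  unfold wedgePairing
  simp only [Matrix.det_apply, Matrix.of_apply]
  refine Finset.analyticAt_fun_sum _ fun σ _ => ?_
  refine AnalyticAt.const_smul ?_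
  refine Finset.analyticAt_fun_prod _ fun a _ => ?_
  exact ((ξ (σ a)).toContinuousLinearMap.analyticAt _).comp (hw a)

/-! ### Unipotent groups of operators -/

section Unipotent

variable {V : Type*} [NormedAddCommGroup V] [NormedSpace ℂ V] [FiniteDimensional ℂ V]
  {ι : Type*}

theorem exp_mul_exp_neg (a : V →L[ℂ] V) : NormedSpace.exp a * NormedSpace.exp (-a) = 1 := by
  have := FiniteDimensional.complete ℂ V
  let _ : NormedAlgebra ℚ (V →L[ℂ] V) := NormedAlgebra.restrictScalars ℚ ℂ _
  rw [← NormedSpace.exp_add_of_commute (Commute.neg_right rfl), add_neg_cancel,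
    NormedSpace.exp_zero]

theorem hasDerivAt_exp_smul (a : V →L[ℂ] V) (t : ℂ) :
    HasDerivAt (fun t : ℂ => NormedSpace.exp (t • a)) (NormedSpace.exp (t • a) * a) t := by
  have := FiniteDimensional.complete ℂ V
  exact hasDerivAt_exp_smul_const a t

theorem commute_exp_smul (a : V →L[ℂ] V) (t : ℂ) :
    NormedSpace.exp (t • a) * a = a * NormedSpace.exp (t • a) :=
  (((Commute.refl a).smul_left t).exp_left).eq

/-- The operators `exp (τ x)`, for `x` in the subspace `𝔪`, act on `V` by unitriangular maps that
preserve `τ`, `𝔪` and the restriction of `χ` to `𝔪`. -/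
structure IsUnipotentAction (τ : V →L[ℂ] V →L[ℂ] V) (𝔪 : Submodule ℂ V) (χ : Dual ℂ V)
    (β : Basis ι ℂ V) (wt : ι → ℝ) : Prop where
  semiconj : ∀ x ∈ 𝔪, ∀ y, NormedSpace.exp (τ x) * τ y =
    τ (NormedSpace.exp (τ x) y) * NormedSpace.exp (τ x)
  stable : ∀ x ∈ 𝔪, ∀ y ∈ 𝔪, NormedSpace.exp (τ x) y ∈ 𝔪
  invariant : ∀ x ∈ 𝔪, ∀ y ∈ 𝔪, χ (NormedSpace.exp (τ x) y) = χ y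
  triangular : ∀ x ∈ 𝔪, ∀ (c : ℝ) (v : V), (∀ i, wt i < c → β.coord i v = 0) →
    ∀ i, wt i ≤ c → β.coord i (NormedSpace.exp (τ x) v) = β.coord i v

/-- The monoid (in fact a group) generated by the operators `exp (τ x)` with `x ∈ 𝔪`. -/
def unipotentMonoid (τ : V →L[ℂ] V →L[ℂ] V) (𝔪 : Submodule ℂ V) : Submonoid (V →L[ℂ] V) :=
  Submonoid.closure {g | ∃ x ∈ 𝔪, NormedSpace.exp (τ x) = g}

variable {τ : V →L[ℂ] V →L[ℂ] V} {𝔪 : Submodule ℂ V} {χ : Dual ℂ V} {β : Basis ι ℂ V}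
  {wt : ι → ℝ} {g : V →L[ℂ] V}

theorem exp_mem_unipotentMonoid {x : V} (hx : x ∈ 𝔪) :
    NormedSpace.exp (τ x) ∈ unipotentMonoid τ 𝔪 :=
  Submonoid.subset_closure ⟨x, hx, rfl⟩

theorem exp_smul_mem_unipotentMonoid {x : V} (hx : x ∈ 𝔪) (t : ℂ) :
    NormedSpace.exp (t • τ x) ∈ unipotentMonoid τ 𝔪 := by
  rw [← map_smul]
  exact exp_mem_unipotentMonoid (𝔪.smul_mem t hx)

theorem exists_inv_of_mem_unipotentMonoid (hg : g ∈ unipotentMonoid τ 𝔪) :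
    ∃ g' ∈ unipotentMonoid τ 𝔪, g * g' = 1 ∧ g' * g = 1 := by
  induction hg using Submonoid.closure_induction with
  | mem g hg =>
    obtain ⟨x, hx, rfl⟩ := hg
    refine ⟨NormedSpace.exp (τ (-x)), exp_mem_unipotentMonoid (𝔪.neg_mem hx), ?_, ?_⟩
    · rw [map_neg, exp_mul_exp_neg]
    · have := exp_mul_exp_neg (-τ x)
      rwa [neg_neg, ← map_neg] at this
  | one => exact ⟨1, Submonoid.one_mem _, by simp, by simp⟩
  | mul a b _ _ ha hb =>
    obtain ⟨a', ha', h1, h2⟩ := ha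
    obtain ⟨b', hb', h3, h4⟩ := hb
    refine ⟨b' * a', Submonoid.mul_mem _ hb' ha', ?_, ?_⟩
    · rw [mul_assoc, ← mul_assoc b, h3, one_mul, h1]
    · rw [mul_assoc, ← mul_assoc a', h2, one_mul, h4]

namespace IsUnipotentAction

variable (H : IsUnipotentAction τ 𝔪 χ β wt)
include H

theorem semiconj_of_mem (hg : g ∈ unipotentMonoid τ 𝔪) (y : V) : g * τ y = τ (g y) * g := by
  induction hg using Submonoid.closure_induction generalizing y with
  | mem g hg =>
    obtain ⟨x, hx, rfl⟩ := hg
    exact H.semiconj x hx y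
  | one => simp
  | mul a b _ _ ha hb => rw [mul_assoc, hb, ← mul_assoc, ha, mul_assoc]; rfl

theorem stable_of_mem (hg : g ∈ unipotentMonoid τ 𝔪) {y : V} (hy : y ∈ 𝔪) : g y ∈ 𝔪 := by
  induction hg using Submonoid.closure_induction generalizing y with
  | mem g hg =>
    obtain ⟨x, hx, rfl⟩ := hg
    exact H.stable x hx y hy
  | one => exact hy
  | mul a b _ _ ha hb => exact ha (hb hy)

theorem invariant_of_mem (hg : g ∈ unipotentMonoid τ 𝔪) {y : V} (hy : y ∈ 𝔪) :
    χ (g y) = χ y := by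
  induction hg using Submonoid.closure_induction generalizing y with
  | mem g hg =>
    obtain ⟨x, hx, rfl⟩ := hg
    exact H.invariant x hx y hy
  | one => rfl
  | mul a b _ hb' ha hb => exact (ha (H.stable_of_mem hb' hy)).trans (hb hy)

theorem triangular_of_mem (hg : g ∈ unipotentMonoid τ 𝔪) {c : ℝ} {v : V}
    (hv : ∀ i, wt i < c → β.coord i v = 0) {i : ι} (hi : wt i ≤ c) :
    β.coord i (g v) = β.coord i v := by
  induction hg using Submonoid.closure_induction generalizing v i with
  | mem g hg =>
    obtain ⟨x, hx, rfl⟩ := hg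
    exact H.triangular x hx c v hv i hi
  | one => rfl
  | mul a b _ _ ha hb =>
    refine (ha (fun j hj => ?_) hi).trans (hb hv hi)
    exact (hb hv hj.le).trans (hv j hj)

end IsUnipotentAction

/-! ### Functions on the group given by Plücker coordinates -/

variable {d : ℕ}

/-- The matrix of the `d`-th tensor power of an operator. -/
def tensorMatrix (β : Basis ι ℂ V) (g : V →L[ℂ] V) (I J : Fin d → ι) : ℂ :=
  ∏ a, β.coord (I a) (g (β (J a)))

/-- The Plücker coordinates of the translate of a family of vectors by an operator. -/
def orbitCoord (β : Basis ι ℂ V) (w : Fin d → V) (g : V →L[ℂ] V) (I : Fin d → ι) : ℂ :=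
  plucker β (fun b => g (w b)) I

/-- The weight of a multi-index. -/
def multiWeight (wt : ι → ℝ) (I : Fin d → ι) : ℝ := ∑ a, wt (I a)

/-- The group acts linearly on Plücker coordinates, through the tensor power matrix. -/
theorem orbitCoord_mul [Fintype ι] (w : Fin d → V) (g g' : V →L[ℂ] V) (I : Fin d → ι) :
    orbitCoord β w (g * g') I = ∑ J, tensorMatrix β g I J * orbitCoord β w g' J :=
  wedgePairing_eq_sum β (fun a => (β.coord (I a)).comp (g : V →ₗ[ℂ] V)) (fun b => g' (w b))

theorem analyticAt_orbitCoord (w : Fin d → V) (I : Fin d → ι) (g : V →L[ℂ] V) :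
    AnalyticAt ℂ (fun g => orbitCoord β w g I) g :=
  analyticAt_wedgePairing _ fun b => (ContinuousLinearMap.apply ℂ V (w b)).analyticAt g

theorem analyticAt_tensorMatrix (I J : Fin d → ι) (g : V →L[ℂ] V) :
    AnalyticAt ℂ (fun g => tensorMatrix β g I J) g := by
  unfold tensorMatrix
  refine Finset.analyticAt_fun_prod _ fun a _ => ?_
  exact ((β.coord (I a)).toContinuousLinearMap.analyticAt _).comp
    ((ContinuousLinearMap.apply ℂ V (β (J a))).analyticAt g)

/-- The derivative of a Plücker coordinate on the group. -/
def orbitDeriv (β : Basis ι ℂ V) (w : Fin d → V) (g : V →L[ℂ] V) (I : Fin d → ι) :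
    (V →L[ℂ] V) →L[ℂ] ℂ :=
  fderiv ℂ (fun g => orbitCoord β w g I) g

theorem hasDerivAt_orbitCoord (w : Fin d → V) (I : Fin d → ι) {γ : ℂ → V →L[ℂ] V}
    {γ' : V →L[ℂ] V} {t : ℂ} (hγ : HasDerivAt γ γ' t) :
    HasDerivAt (fun t => orbitCoord β w (γ t) I) (orbitDeriv β w (γ t) I γ') t :=
  (analyticAt_orbitCoord w I (γ t)).differentiableAt.hasFDerivAt.comp_hasDerivAt t hγ

theorem orbitDeriv_mul_left [Fintype ι] (w : Fin d → V) (g h a : V →L[ℂ] V) (I : Fin d → ι) :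
    orbitDeriv β w (g * h) I (g * a) = ∑ J, tensorMatrix β g I J * orbitDeriv β w h J a := by
  have h0 : HasDerivAt (fun t : ℂ => h + t • a) a 0 := by
    simpa using ((hasDerivAt_id (0 : ℂ)).smul_const a).const_add h
  have h1 : HasDerivAt (fun t : ℂ => g * (h + t • a)) (g * a) 0 := h0.const_mul g
  have h2 := hasDerivAt_orbitCoord (β := β) w I h1
  have h3 : HasDerivAt (fun t : ℂ => ∑ J, tensorMatrix β g I J * orbitCoord β w (h + t • a) J)
      (∑ J, tensorMatrix β g I J * orbitDeriv β w (h + (0 : ℂ) • a) J a) 0 :=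
    HasDerivAt.fun_sum fun J _ => (hasDerivAt_orbitCoord (β := β) w J h0).const_mul _
  simp only [orbitCoord_mul] at h2
  simpa using h2.unique h3

/-- Here the variation is on the left of `h`, so the result depends on `h` only through its Plücker
coordinates. In `orbitDeriv_mul_left` the derivative at `h` is instead translated by `g`. -/
theorem orbitDeriv_mul_right [Fintype ι] (w : Fin d → V) (h a : V →L[ℂ] V) (I : Fin d → ι) :
    orbitDeriv β w h I (a * h) =
      ∑ J, fderiv ℂ (fun g => tensorMatrix β g I J) 1 a * orbitCoord β w h J := by
  have h0 : HasDerivAt (fun t : ℂ => 1 + t • a) a 0 := by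
    simpa using ((hasDerivAt_id (0 : ℂ)).smul_const a).const_add 1
  have h1 : HasDerivAt (fun t : ℂ => (1 + t • a) * h) (a * h) 0 := h0.mul_const h
  have h2 := hasDerivAt_orbitCoord (β := β) w I h1
  have h3 : HasDerivAt (fun t : ℂ => ∑ J, tensorMatrix β (1 + t • a) I J * orbitCoord β w h J)
      (∑ J, fderiv ℂ (fun g => tensorMatrix β g I J) (1 + (0 : ℂ) • a) a * orbitCoord β w h J) 0 :=
    HasDerivAt.fun_sum fun J _ => HasDerivAt.mul_const
      ((analyticAt_tensorMatrix I J _).differentiableAt.hasFDerivAt.comp_hasDerivAt 0 h0) _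
  simp only [orbitCoord_mul] at h2
  simpa using h2.unique h3

namespace IsUnipotentAction

variable (H : IsUnipotentAction τ 𝔪 χ β wt)
include H

theorem coord_apply_basis (hg : g ∈ unipotentMonoid τ 𝔪) {i j : ι} (hij : wt i ≤ wt j) :
    β.coord i (g (β j)) = β.coord i (β j) := by
  classical
  refine H.triangular_of_mem hg (fun k hk => ?_) hij
  have : j ≠ k := by rintro rfl; exact hk.false
  simp [this]

-- Each factor of the product is a Kronecker delta unless the weight strictly increases from `J a`
-- to `I a`. A nonzero entry with `I ≠ J` therefore forces the total weight to increase.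
open scoped Classical in
theorem tensorMatrix_eq_ite (hg : g ∈ unipotentMonoid τ 𝔪) {I J : Fin d → ι}
    (hIJ : ¬ multiWeight wt J < multiWeight wt I) :
    tensorMatrix β g I J = if I = J then 1 else 0 := by
  split_ifs with h
  · subst h
    refine Finset.prod_eq_one fun a _ => ?_
    rw [H.coord_apply_basis hg le_rfl]
    simp
  · by_contra hne
    have h1 : ∀ a, I a = J a ∨ wt (J a) < wt (I a) := by
      intro a
      by_contra! hcon
      refine hne (Finset.prod_eq_zero (Finset.mem_univ a) ?_)
      rw [H.coord_apply_basis hg hcon.2]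
      simp [hcon.1.symm]
    obtain ⟨a, ha⟩ := Function.ne_iff.1 h
    refine hIJ (Finset.sum_lt_sum (fun b _ => ?_) ⟨a, Finset.mem_univ a, ?_⟩)
    · rcases h1 b with hb | hb
      · rw [hb]
      · exact hb.le
    · exact (h1 a).resolve_left ha

/-- The form in which unitriangularity is used throughout: the components of lowest weight of a
vector are not changed by the group. -/
theorem sum_tensorMatrix_mul [Fintype ι] (hg : g ∈ unipotentMonoid τ 𝔪) {I : Fin d → ι}
    {f : (Fin d → ι) → ℂ} (hf : ∀ J, multiWeight wt J < multiWeight wt I → f J = 0) :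
    ∑ J, tensorMatrix β g I J * f J = f I := by
  classical
  rw [Finset.sum_eq_single I]
  · rw [H.tensorMatrix_eq_ite hg (lt_irrefl _), if_pos rfl, one_mul]
  · intro J _ hJ
    by_cases h : multiWeight wt J < multiWeight wt I
    · rw [hf J h, mul_zero]
    · rw [H.tensorMatrix_eq_ite hg h, if_neg (Ne.symm hJ), zero_mul]
  · simp

/-- Such an entry is constant along the one-parameter group of `x`. -/
theorem fderiv_tensorMatrix_eq_zero {x : V} (hx : x ∈ 𝔪) {I J : Fin d → ι}
    (hIJ : ¬ multiWeight wt J < multiWeight wt I) :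
    fderiv ℂ (fun g => tensorMatrix β g I J) 1 (τ x) = 0 := by
  classical
  have h0 : HasDerivAt (fun t : ℂ => NormedSpace.exp (t • τ x)) (τ x) 0 := by
    simpa using hasDerivAt_exp_smul (τ x) 0
  have h1 := (analyticAt_tensorMatrix (β := β) I J
    (NormedSpace.exp ((0 : ℂ) • τ x))).differentiableAt.hasFDerivAt.comp_hasDerivAt 0 h0
  have h2 : (fun g => tensorMatrix β g I J) ∘ (fun t : ℂ => NormedSpace.exp (t • τ x)) =
      fun _ => if I = J then 1 else 0 :=
    funext fun t => H.tensorMatrix_eq_ite (exp_smul_mem_unipotentMonoid hx t) hIJ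
  rw [h2] at h1
  have h3 := h1.unique (hasDerivAt_const 0 _)
  rwa [zero_smul, NormedSpace.exp_zero] at h3

end IsUnipotentAction

/-! ### Products of one-parameter groups -/

variable {Z : Type*} [NormedAddCommGroup Z] [NormedSpace ℂ Z]

/-- The analytic map `s` takes values in the unipotent group, and the pull-back by `s` of
the right-invariant 1-form of the group given by `χ` is the differential of the function `q`. -/
structure IsPrimitive (τ : V →L[ℂ] V →L[ℂ] V) (𝔪 : Submodule ℂ V) (χ : Dual ℂ V)
    (s : Z → V →L[ℂ] V) (q : Z → ℂ) : Prop where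
  mem : ∀ z, s z ∈ unipotentMonoid τ 𝔪
  analyticAt : ∀ z, AnalyticAt ℂ s z
  analyticAt_primitive : ∀ z, AnalyticAt ℂ q z
  exists_fderiv : ∀ z v, ∃ a ∈ 𝔪, fderiv ℂ s z v = τ a * s z ∧ χ a = fderiv ℂ q z v

theorem isPrimitive_one : IsPrimitive τ 𝔪 χ (fun _ : Z => (1 : V →L[ℂ] V)) 0 where
  mem _ := Submonoid.one_mem _
  analyticAt _ := analyticAt_const
  analyticAt_primitive _ := analyticAt_const
  exists_fderiv z v := ⟨0, 𝔪.zero_mem, by simp, by simp⟩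

/-- The new factor contributes `dp · s τ(x) s⁻¹ = dp · τ(s x)` to the right logarithmic derivative.
As `χ (s x) = χ x`, the 1-form changes by `χ x · dp`, which is exact. -/
theorem IsPrimitive.mul_exp (H : IsUnipotentAction τ 𝔪 χ β wt) {s : Z → V →L[ℂ] V} {q p : Z → ℂ}
    (hs : IsPrimitive τ 𝔪 χ s q) (hp : ∀ z, AnalyticAt ℂ p z) {x : V} (hx : x ∈ 𝔪) :
    IsPrimitive τ 𝔪 χ (fun z => s z * NormedSpace.exp (p z • τ x)) (fun z => q z + p z * χ x) where
  mem z := Submonoid.mul_mem _ (hs.mem z) (exp_smul_mem_unipotentMonoid hx _)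
  analyticAt z := by
    have := FiniteDimensional.complete ℂ V
    refine (hs.analyticAt z).mul ?_
    exact AnalyticAt.comp (f := fun z => p z • τ x) (NormedSpace.exp_analytic (𝕂 := ℂ) (p z • τ x))
      ((hp z).smul analyticAt_const)
  analyticAt_primitive z := (hs.analyticAt_primitive z).add ((hp z).mul analyticAt_const)
  exists_fderiv z v := by
    obtain ⟨a, ha, h1, h2⟩ := hs.exists_fderiv z v
    have hpd := (hp z).differentiableAt.hasFDerivAt
    have hsd := (hs.analyticAt z).differentiableAt.hasFDerivAt
    have hqd := (hs.analyticAt_primitive z).differentiableAt.hasFDerivAt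
    refine ⟨a + fderiv ℂ p z v • s z x,
      𝔪.add_mem ha (𝔪.smul_mem _ (H.stable_of_mem (hs.mem z) hx)), ?_, ?_⟩
    · have h3 := (hasDerivAt_exp_smul (τ x) (p z)).hasFDerivAt.comp z hpd
      have h4 := hsd.mul' h3
      rw [show (fun z => s z * NormedSpace.exp (p z • τ x)) =
        s * ((fun t : ℂ => NormedSpace.exp (t • τ x)) ∘ p) from rfl, h4.fderiv]
      simp only [Function.comp_apply, add_apply,
        smul_apply, ContinuousLinearMap.comp_apply, h1,
        ContinuousLinearMap.toSpanSingleton_apply, smul_eq_mul, MulOpposite.smul_eq_mul_unop,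
        MulOpposite.unop_op, map_add, map_smul, add_mul, commute_exp_smul, smul_mul_assoc,
        mul_smul_comm]
      rw [← mul_assoc (s z), H.semiconj_of_mem (hs.mem z), add_comm, mul_assoc, mul_assoc]
    · have h5 : HasFDerivAt (fun z => q z + p z * χ x) _ z := hqd.add (hpd.mul_const (χ x))
      rw [h5.fderiv, map_add, map_smul, h2, H.invariant_of_mem (hs.mem z) hx]
      simp [mul_comm]

end Unipotent

/-! ### Parametrization of the orbits of unipotent groups -/

section Orbit

variable {V : Type*} [NormedAddCommGroup V] [NormedSpace ℂ V] [FiniteDimensional ℂ V]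
  {ι : Type*} [Fintype ι] {d : ℕ}
  {τ : V →L[ℂ] V →L[ℂ] V} {𝔪 : Submodule ℂ V} {χ : Dual ℂ V} {β : Basis ι ℂ V}
  {wt : ι → ℝ} {g : V →L[ℂ] V}

/-- The elements of `𝔪` whose infinitesimal action does not change the Plücker coordinates in
`S`. -/
def infinitesimalStabilizer (τ : V →L[ℂ] V →L[ℂ] V) (𝔪 : Submodule ℂ V) (β : Basis ι ℂ V)
    (w : Fin d → V) (S : Finset (Fin d → ι)) : Submodule ℂ V :=
  𝔪 ⊓ ⨅ I ∈ S, LinearMap.ker ((orbitDeriv β w 1 I).comp τ).toLinearMap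

theorem mem_infinitesimalStabilizer {w : Fin d → V} {S : Finset (Fin d → ι)} {x : V} :
    x ∈ infinitesimalStabilizer τ 𝔪 β w S ↔
      x ∈ 𝔪 ∧ ∀ I ∈ S, orbitDeriv β w 1 I (τ x) = 0 := by
  simp [infinitesimalStabilizer, Submodule.mem_iInf]

theorem eq_add_mul_of_hasDerivAt_const {f : ℂ → ℂ} {c : ℂ} (hf : ∀ t, HasDerivAt f c t) (t : ℂ) :
    f t = f 0 + t * c := by
  have h1 : ∀ t, HasDerivAt (fun t => f t - t * c) 0 t := fun t => by
    have h := (hf t).sub ((hasDerivAt_id t).mul_const c)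
    rw [one_mul, sub_self] at h
    exact h
  have h2 := is_const_of_deriv_eq_zero (fun t => (h1 t).differentiableAt)
    (fun t => (h1 t).deriv) t 0
  simp only [zero_mul, sub_zero] at h2
  rw [← h2, sub_add_cancel]

theorem finrank_inf_ker_add_one {N : Submodule ℂ V} {f : V →ₗ[ℂ] ℂ} {x : V} (hx : x ∈ N)
    (hfx : f x ≠ 0) :
    finrank ℂ (N ⊓ LinearMap.ker f : Submodule ℂ V) + 1 = finrank ℂ N := by
  have h1 := LinearMap.finrank_range_add_finrank_ker (f.domRestrict N)
  have h2 : LinearMap.range (f.domRestrict N) = ⊤ := by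
    refine LinearMap.range_eq_top.2 fun c => ⟨(c / f x) • ⟨x, hx⟩, ?_⟩
    simp [hfx]
  have h3 : finrank ℂ (LinearMap.ker (f.domRestrict N)) =
      finrank ℂ (N ⊓ LinearMap.ker f : Submodule ℂ V) := by
    have : (LinearMap.ker (f.domRestrict N)).map N.subtype = N ⊓ LinearMap.ker f := by
      ext y; simp [Submodule.mem_inf, and_comm]
    rw [← Submodule.finrank_map_subtype_eq, this]
  rw [h2, finrank_top, finrank_self, h3] at h1
  omega

/-- The analytic map `s`, which depends only on the coordinates in `J`, parametrizes an orbit as far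
as the Plücker coordinates in `S` can see, and those in `J` are the parameters. -/
structure IsOrbitSection (τ : V →L[ℂ] V →L[ℂ] V) (𝔪 : Submodule ℂ V) (χ : Dual ℂ V)
    (β : Basis ι ℂ V) (w : Fin d → V) (S J : Finset (Fin d → ι))
    (s : ((Fin d → ι) → ℂ) → V →L[ℂ] V) (q : ((Fin d → ι) → ℂ) → ℂ) : Prop where
  isPrimitive : IsPrimitive τ 𝔪 χ s q
  subset : J ⊆ S
  congr : ∀ z z', (∀ I ∈ J, z I = z' I) → s z = s z'
  coord : ∀ z, ∀ I ∈ J, orbitCoord β w (s z) I = z I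
  one : s (orbitCoord β w 1) = 1
  surj : ∀ g ∈ unipotentMonoid τ 𝔪, ∀ I ∈ S,
    orbitCoord β w g I = orbitCoord β w (s (orbitCoord β w g)) I
  card : J.card + finrank ℂ (infinitesimalStabilizer τ 𝔪 β w S) = finrank ℂ 𝔪

theorem isOrbitSection_empty (w : Fin d → V) :
    IsOrbitSection τ 𝔪 χ β w ∅ ∅ (fun _ => 1) 0 where
  isPrimitive := isPrimitive_one
  subset := by simp
  congr _ _ _ := rfl
  coord := by simp
  one := rfl
  surj := by simp
  card := by
    have : infinitesimalStabilizer τ 𝔪 β w ∅ = 𝔪 := by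
      ext; simp [mem_infinitesimalStabilizer]
    rw [this, Finset.card_empty, zero_add]

variable (H : IsUnipotentAction τ 𝔪 χ β wt)
include H

/-- By unitriangularity the derivative along the one-parameter group is the same at every `t`: all
derivatives of lower weight vanish. The coordinate is thus affine in `t`. -/
theorem orbitCoord_exp {w : Fin d → V} {S : Finset (Fin d → ι)} {x : V} {c : ℂ}
    {I : Fin d → ι} (hS : ∀ J, multiWeight wt J < multiWeight wt I → J ∈ S)
    (hx : x ∈ infinitesimalStabilizer τ 𝔪 β w S) (hc : orbitDeriv β w 1 I (τ x) = c) (t : ℂ) :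
    orbitCoord β w (NormedSpace.exp (t • τ x)) I = orbitCoord β w 1 I + t * c := by
  obtain ⟨hxm, hxS⟩ := mem_infinitesimalStabilizer.1 hx
  have h1 : ∀ t : ℂ, HasDerivAt (fun t : ℂ => orbitCoord β w (NormedSpace.exp (t • τ x)) I) c t := by
    intro t
    have h2 := hasDerivAt_orbitCoord (β := β) w I (hasDerivAt_exp_smul (τ x) t)
    have h3 := orbitDeriv_mul_left (β := β) w (NormedSpace.exp (t • τ x)) 1 (τ x) I
    rw [H.sum_tensorMatrix_mul (exp_smul_mem_unipotentMonoid hxm t)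
      (fun J hJ => hxS J (hS J hJ)), mul_one, hc] at h3
    rwa [h3] at h2
  have := eq_add_mul_of_hasDerivAt_const h1 t
  simpa using this

/-- The increment computed in `orbitCoord_exp` vanishes in lower weights, so left translation by `g`
leaves it unchanged. -/
theorem orbitCoord_mul_exp {w : Fin d → V} {S : Finset (Fin d → ι)} {x : V} {c : ℂ}
    {I : Fin d → ι} (hS : ∀ J, multiWeight wt J < multiWeight wt I → J ∈ S)
    (hSlow : ∀ I ∈ S, ∀ J, multiWeight wt J < multiWeight wt I → J ∈ S)
    (hx : x ∈ infinitesimalStabilizer τ 𝔪 β w S) (hc : orbitDeriv β w 1 I (τ x) = c)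
    (hg : g ∈ unipotentMonoid τ 𝔪) (t : ℂ) :
    orbitCoord β w (g * NormedSpace.exp (t • τ x)) I = orbitCoord β w g I + t * c := by
  have hxS := (mem_infinitesimalStabilizer.1 hx).2
  have h1 := orbitCoord_mul (β := β) w g 1 I
  have h2 := orbitCoord_mul (β := β) w g (NormedSpace.exp (t • τ x)) I
  have h3 := H.sum_tensorMatrix_mul hg (I := I)
    (f := fun J => orbitCoord β w (NormedSpace.exp (t • τ x)) J - orbitCoord β w 1 J)
    (fun J hJ => by
      rw [orbitCoord_exp H (hSlow J (hS J hJ)) hx (hxS J (hS J hJ)), mul_zero, add_zero, sub_self])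
  simp only [mul_sub, Finset.sum_sub_distrib] at h3
  rw [← h2, ← h1, mul_one, orbitCoord_exp H hS hx hc, add_sub_cancel_left] at h3
  rw [← h3, add_sub_cancel]

-- The free case. Right multiplication by `exp (t τ x)` shifts the coordinate `I₀` by `t` and fixes
-- those in `S`, so `t` can be chosen to give it any prescribed value. One parameter is gained and
-- the infinitesimal stabilizer loses one dimension.
open scoped Classical in
theorem IsOrbitSection.insert_of_ne_zero {w : Fin d → V} {S J : Finset (Fin d → ι)}
    {s : ((Fin d → ι) → ℂ) → V →L[ℂ] V} {q : ((Fin d → ι) → ℂ) → ℂ}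
    (hs : IsOrbitSection τ 𝔪 χ β w S J s q) {I₀ : Fin d → ι} (hI₀ : I₀ ∉ S)
    (hS : ∀ J, multiWeight wt J < multiWeight wt I₀ → J ∈ S)
    (hSlow : ∀ I ∈ S, ∀ J, multiWeight wt J < multiWeight wt I → J ∈ S) {x : V}
    (hx : x ∈ infinitesimalStabilizer τ 𝔪 β w S) (hx₀ : orbitDeriv β w 1 I₀ (τ x) = 1) :
    IsOrbitSection τ 𝔪 χ β w (insert I₀ S) (insert I₀ J)
      (fun z => s z * NormedSpace.exp ((z I₀ - orbitCoord β w (s z) I₀) • τ x))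
      (fun z => q z + (z I₀ - orbitCoord β w (s z) I₀) * χ x) := by
  obtain ⟨hxm, hxS⟩ := mem_infinitesimalStabilizer.1 hx
  have hcoordS : ∀ z t, ∀ I ∈ S, orbitCoord β w (s z * NormedSpace.exp (t • τ x)) I =
      orbitCoord β w (s z) I := fun z t I hI => by
    rw [orbitCoord_mul_exp H (hSlow I hI) hSlow hx (hxS I hI) (hs.isPrimitive.mem z), mul_zero,
      add_zero]
  have hcoord₀ : ∀ z, orbitCoord β w (s z *
      NormedSpace.exp ((z I₀ - orbitCoord β w (s z) I₀) • τ x)) I₀ = z I₀ := fun z => by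
    rw [orbitCoord_mul_exp H hS hSlow hx hx₀ (hs.isPrimitive.mem z), mul_one, add_sub_cancel]
  refine ⟨?_, Finset.insert_subset_insert _ hs.subset, ?_, ?_, ?_, ?_, ?_⟩
  · refine hs.isPrimitive.mul_exp H (fun z => ?_) hxm
    refine AnalyticAt.sub ?_ ?_
    · exact (ContinuousLinearMap.proj (R := ℂ) (φ := fun _ : Fin d → ι => ℂ) I₀).analyticAt z
    · exact (analyticAt_orbitCoord w I₀ (s z)).comp (hs.isPrimitive.analyticAt z)
  · intro z z' h
    rw [hs.congr z z' fun I hI => h I (Finset.mem_insert_of_mem hI),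
      h I₀ (Finset.mem_insert_self _ _)]
  · intro z I hI
    rcases Finset.mem_insert.1 hI with rfl | hI
    · exact hcoord₀ z
    · rw [hcoordS z _ I (hs.subset hI), hs.coord z I hI]
  · simp [hs.one]
  · intro g hg I hI
    rcases Finset.mem_insert.1 hI with rfl | hI
    · rw [hcoord₀]
    · rw [hcoordS _ _ I hI, hs.surj g hg I hI]
  · have h1 : infinitesimalStabilizer τ 𝔪 β w (insert I₀ S) =
        infinitesimalStabilizer τ 𝔪 β w S ⊓
          LinearMap.ker ((orbitDeriv β w 1 I₀).comp τ).toLinearMap := by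
      ext y
      simp [mem_infinitesimalStabilizer, and_left_comm, and_comm]
    have h2 := finrank_inf_ker_add_one (f := ((orbitDeriv β w 1 I₀).comp τ).toLinearMap) hx
      (by simp [hx₀])
    have h3 := hs.card
    rw [Finset.card_insert_of_notMem fun h => hI₀ (hs.subset h), h1]
    omega

/-- If an infinitesimal motion changes two points with the same Plücker coordinates in `S` in different
ways, it does so in `S`. -/
theorem orbitDeriv_eq_zero_of_forall {w : Fin d → V} {S : Finset (Fin d → ι)} {I₀ : Fin d → ι}
    (hS : ∀ J, multiWeight wt J < multiWeight wt I₀ → J ∈ S)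
    (hSlow : ∀ I ∈ S, ∀ J, multiWeight wt J < multiWeight wt I → J ∈ S)
    (hx₀ : ∀ x ∈ infinitesimalStabilizer τ 𝔪 β w S, orbitDeriv β w 1 I₀ (τ x) = 0)
    (hg : g ∈ unipotentMonoid τ 𝔪) {y : V} (hy : y ∈ 𝔪)
    (h : ∀ I ∈ S, orbitDeriv β w g I (τ y * g) = 0) :
    orbitDeriv β w g I₀ (τ y * g) = 0 := by
  obtain ⟨g', hg', hgg', hg'g⟩ := exists_inv_of_mem_unipotentMonoid hg
  -- Conjugation by `g` transports the motion to the identity, where `g⁻¹ y` turns out to stabilize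
  -- the coordinates in `S`.
  have h1 : τ y * g = g * τ (g' y) := by
    rw [H.semiconj_of_mem hg, ← mul_apply_eq_comp, hgg']; rfl
  have h2 : g' y ∈ infinitesimalStabilizer τ 𝔪 β w S := by
    refine mem_infinitesimalStabilizer.2 ⟨H.stable_of_mem hg' hy, fun I hI => ?_⟩
    have h3 := orbitDeriv_mul_left (β := β) w g' g (τ y * g) I
    rw [H.sum_tensorMatrix_mul hg' fun J hJ => h J (hSlow I hI J hJ), h I hI, h1, ← mul_assoc,
      hg'g, one_mul] at h3
    exact h3
  have h4 := orbitDeriv_mul_left (β := β) w g 1 (τ (g' y)) I₀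
  rw [H.sum_tensorMatrix_mul hg fun J hJ =>
    (mem_infinitesimalStabilizer.1 h2).2 J (hS J hJ), hx₀ _ h2, mul_one] at h4
  rw [h1, h4]

/-- The infinitesimal action of `y` on a coordinate involves only coordinates of strictly lower
weight, all of them in `S`. -/
theorem orbitDeriv_congr {w : Fin d → V} {S : Finset (Fin d → ι)} {I : Fin d → ι}
    (hS : ∀ J, multiWeight wt J < multiWeight wt I → J ∈ S) {g' : V →L[ℂ] V}
    (h : ∀ J ∈ S, orbitCoord β w g J = orbitCoord β w g' J) {y : V} (hy : y ∈ 𝔪) :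
    orbitDeriv β w g I (τ y * g) = orbitDeriv β w g' I (τ y * g') := by
  rw [orbitDeriv_mul_right, orbitDeriv_mul_right]
  refine Finset.sum_congr rfl fun J _ => ?_
  by_cases hJ : multiWeight wt J < multiWeight wt I
  · rw [h J (hS J hJ)]
  · rw [H.fderiv_tensorMatrix_eq_zero hy hJ, zero_mul, zero_mul]

-- The dependent case: on the group the coordinate `I₀` is a function of those in `S`. A path in the
-- group is compared with the section path having the same coordinates in `S`. The two velocities
-- differ by an infinitesimal motion that is invisible in `S`, hence also in `I₀`.
open scoped Classical in
theorem IsOrbitSection.insert_of_eq_zero {w : Fin d → V} {S J : Finset (Fin d → ι)}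
    {s : ((Fin d → ι) → ℂ) → V →L[ℂ] V} {q : ((Fin d → ι) → ℂ) → ℂ}
    (hs : IsOrbitSection τ 𝔪 χ β w S J s q) {I₀ : Fin d → ι}
    (hS : ∀ J, multiWeight wt J < multiWeight wt I₀ → J ∈ S)
    (hSlow : ∀ I ∈ S, ∀ J, multiWeight wt J < multiWeight wt I → J ∈ S)
    (hx₀ : ∀ x ∈ infinitesimalStabilizer τ 𝔪 β w S, orbitDeriv β w 1 I₀ (τ x) = 0) :
    IsOrbitSection τ 𝔪 χ β w (insert I₀ S) J s q := by
  have h1 : infinitesimalStabilizer τ 𝔪 β w (insert I₀ S) =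
      infinitesimalStabilizer τ 𝔪 β w S := by
    ext y
    rw [mem_infinitesimalStabilizer, mem_infinitesimalStabilizer]
    refine and_congr_right fun hy => ⟨fun h I hI => h I (Finset.mem_insert_of_mem hI), ?_⟩
    intro h I hI
    rcases Finset.mem_insert.1 hI with rfl | hI
    · exact hx₀ y (mem_infinitesimalStabilizer.2 ⟨hy, h⟩)
    · exact h I hI
  refine ⟨hs.isPrimitive, hs.subset.trans (Finset.subset_insert _ _), hs.congr, hs.coord, hs.one,
    ?_, h1 ▸ hs.card⟩
  intro g hg I hI
  rcases Finset.mem_insert.1 hI with rfl | hI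
  swap
  · exact hs.surj g hg I hI
  unfold unipotentMonoid at hg
  -- Generators are added on the left, so that the connecting path satisfies `γ' = τ x * γ`, on the
  -- same side as in `IsPrimitive`.
  induction hg using Submonoid.closure_induction_left with
  | one => rw [hs.one]
  | mul_left a ha g hg ih =>
    obtain ⟨x, hx, rfl⟩ := ha
    change g ∈ unipotentMonoid τ 𝔪 at hg
    let γ : ℂ → V →L[ℂ] V := fun t => NormedSpace.exp (t • τ x) * g
    let z : ℂ → (Fin d → ι) → ℂ := fun t => orbitCoord β w (γ t)
    have hγm : ∀ t, γ t ∈ unipotentMonoid τ 𝔪 := fun t =>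
      Submonoid.mul_mem _ (exp_smul_mem_unipotentMonoid hx t) hg
    have hγ : ∀ t, HasDerivAt γ (τ x * γ t) t := fun t => by
      have := (hasDerivAt_exp_smul (τ x) t).mul_const g
      rwa [commute_exp_smul, mul_assoc] at this
    have hδ : ∀ t, HasDerivAt
        (fun t => orbitCoord β w (γ t) I - orbitCoord β w (s (z t)) I) 0 t := by
      intro t
      have hz : HasDerivAt z (fun K => orbitDeriv β w (γ t) K (τ x * γ t)) t :=
        hasDerivAt_pi.2 fun K => hasDerivAt_orbitCoord (β := β) w K (hγ t)
      obtain ⟨a, ha, hsa, -⟩ := hs.isPrimitive.exists_fderiv (z t)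
        (fun K => orbitDeriv β w (γ t) K (τ x * γ t))
      have hsz : HasDerivAt (fun t => s (z t)) (τ a * s (z t)) t := by
        rw [← hsa]
        exact (hs.isPrimitive.analyticAt (z t)).differentiableAt.hasFDerivAt.comp_hasDerivAt t hz
      have hsame : ∀ t, ∀ K ∈ S, orbitCoord β w (γ t) K = orbitCoord β w (s (z t)) K :=
        fun t K hK => hs.surj _ (hγm t) K hK
      have hD : ∀ K, (∀ L, multiWeight wt L < multiWeight wt K → L ∈ S) → HasDerivAt
          (fun t => orbitCoord β w (γ t) K - orbitCoord β w (s (z t)) K)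
          (orbitDeriv β w (s (z t)) K (τ (x - a) * s (z t))) t := by
        intro K hK
        have h2 := (hasDerivAt_orbitCoord (β := β) w K (hγ t)).sub
          (hasDerivAt_orbitCoord (β := β) w K hsz)
        rwa [orbitDeriv_congr H hK (hsame t) hx, ← map_sub, ← sub_mul, ← map_sub] at h2
      -- For `K ∈ S` the difference of coordinates is identically zero, so `x - a` does not move any
      -- coordinate in `S` at `s (z t)`.
      have h0 := orbitDeriv_eq_zero_of_forall H hS hSlow hx₀ (hs.isPrimitive.mem (z t))
        (𝔪.sub_mem hx ha) fun K hK => by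
          refine (hD K (hSlow K hK)).unique ((hasDerivAt_const t (0 : ℂ)).congr_of_eventuallyEq ?_)
          exact Filter.Eventually.of_forall fun t => by simp [hsame t K hK]
      rw [← h0]
      exact hD I hS
    have h3 := eq_add_mul_of_hasDerivAt_const hδ 1
    have h4 : orbitCoord β w (γ 0) I = orbitCoord β w (s (z 0)) I := by
      simpa [z, γ] using ih
    rw [h4, sub_self, mul_zero, add_zero, sub_eq_zero] at h3
    simpa [z, γ] using h3

theorem exists_isOrbitSection (w : Fin d → V) :
    ∃ J s q, IsOrbitSection τ 𝔪 χ β w Finset.univ J s q := by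
  classical
  suffices h : ∀ S : Finset (Fin d → ι),
      (∀ I ∈ S, ∀ J, multiWeight wt J < multiWeight wt I → J ∈ S) →
      ∃ J s q, IsOrbitSection τ 𝔪 χ β w S J s q from h Finset.univ (by simp)
  intro S
  -- Multi-indices enter by increasing weight. Each set reached contains everything of strictly
  -- smaller weight than its members, and ties are harmless.
  induction S using Finset.induction_on_max_value (multiWeight wt) with
  | empty => exact fun _ => ⟨_, _, _, isOrbitSection_empty w⟩
  | insert I₀ S hI₀ hmax ih =>
    intro hlow
    have hSlow : ∀ I ∈ S, ∀ J, multiWeight wt J < multiWeight wt I → J ∈ S := by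
      intro I hI J hJ
      refine (Finset.mem_insert.1 (hlow I (Finset.mem_insert_of_mem hI) J hJ)).resolve_left ?_
      rintro rfl
      exact (hmax I hI).not_gt hJ
    have hS : ∀ J, multiWeight wt J < multiWeight wt I₀ → J ∈ S := by
      intro J hJ
      refine (Finset.mem_insert.1 (hlow I₀ (Finset.mem_insert_self _ _) J hJ)).resolve_left ?_
      rintro rfl
      exact hJ.false
    obtain ⟨J, s, q, hs⟩ := ih hSlow
    by_cases hx : ∀ x ∈ infinitesimalStabilizer τ 𝔪 β w S, orbitDeriv β w 1 I₀ (τ x) = 0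
    · exact ⟨_, _, _, hs.insert_of_eq_zero H hS hSlow hx⟩
    · push Not at hx
      obtain ⟨x, hxS, hx₀⟩ := hx
      refine ⟨_, _, _, hs.insert_of_ne_zero H hI₀ hS hSlow
        (x := (orbitDeriv β w 1 I₀ (τ x))⁻¹ • x) (Submodule.smul_mem _ _ hxS) ?_⟩
      rw [map_smul, map_smul, smul_eq_mul, inv_mul_cancel₀ hx₀]

end Orbit

/-! ### Local structure of the orbits in the Grassmannian -/

section Slice

variable {V : Type*} [NormedAddCommGroup V] [NormedSpace ℂ V] [FiniteDimensional ℂ V]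
  {ι : Type*} {d m : ℕ}
  {τ : V →L[ℂ] V →L[ℂ] V} {𝔪 : Submodule ℂ V} {χ : Dual ℂ V} {β : Basis ι ℂ V}
  {wt : ι → ℝ} {g : V →L[ℂ] V}

/-- The orbit of a subspace under the unipotent group. -/
def unipotentOrbit (τ : V →L[ℂ] V →L[ℂ] V) (𝔪 W : Submodule ℂ V) : Set (Submodule ℂ V) :=
  {W' | ∃ g ∈ unipotentMonoid τ 𝔪, W' = W.map (g : V →ₗ[ℂ] V)}

theorem map_span_range (g : V →L[ℂ] V) (w : Fin d → V) :
    (Submodule.span ℂ (Set.range w)).map (g : V →ₗ[ℂ] V) =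
      Submodule.span ℂ (Set.range fun b => g (w b)) := by
  rw [Submodule.map_span, ← Set.range_comp]; rfl

theorem linearIndependent_of_mem (hg : g ∈ unipotentMonoid τ 𝔪) {w : Fin d → V}
    (hw : LinearIndependent ℂ w) : LinearIndependent ℂ fun b => g (w b) := by
  obtain ⟨g', -, -, h⟩ := exists_inv_of_mem_unipotentMonoid hg
  refine hw.map' (g : V →ₗ[ℂ] V) (LinearMap.ker_eq_bot.2 ?_)
  exact Function.LeftInverse.injective (g := g') fun v => congrArg (fun T : V →L[ℂ] V => T v) h

theorem exp_apply_mem {W : Submodule ℂ V} {a : V →L[ℂ] V} (ha : ∀ v ∈ W, a v ∈ W) {v : V}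
    (hv : v ∈ W) : NormedSpace.exp a v ∈ W := by
  have := FiniteDimensional.complete ℂ V
  have h1 := (ContinuousLinearMap.apply ℂ V v).hasSum
    (NormedSpace.exp_series_hasSum_exp' (𝕂 := ℂ) a)
  have h2 : ∀ n : ℕ, (a ^ n) v ∈ W := fun n => by
    induction n with
    | zero => simpa
    | succ n ih => rw [pow_succ']; exact ha _ ih
  refine W.closed_of_finiteDimensional.mem_of_tendsto h1 (Filter.Eventually.of_forall fun s => ?_)
  exact W.sum_mem fun n _ => W.smul_mem _ (h2 n)

variable [Fintype ι]

theorem span_eq_of_orbitCoord_eq {w : Fin d → V} (hw : LinearIndependent ℂ w) {g' : V →L[ℂ] V}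
    (hg : g ∈ unipotentMonoid τ 𝔪) (hg' : g' ∈ unipotentMonoid τ 𝔪)
    (h : ∀ I, orbitCoord β w g I = orbitCoord β w g' I) :
    Submodule.span ℂ (Set.range fun b => g (w b)) =
      Submodule.span ℂ (Set.range fun b => g' (w b)) := by
  refine span_eq_of_wedgePairing_eq_mul (c := 1) (linearIndependent_of_mem hg hw)
    (linearIndependent_of_mem hg' hw) (fun ξ => ?_) one_ne_zero
  rw [one_mul, wedgePairing_eq_sum β, wedgePairing_eq_sum β]
  exact Finset.sum_congr rfl fun I _ => congrArg _ (h I)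

variable (H : IsUnipotentAction τ 𝔪 χ β wt)
include H

/-- Some nonzero Plücker coordinate is constant on the orbit. -/
theorem exists_invariant_coord {w : Fin d → V} (hw : LinearIndependent ℂ w) :
    ∃ I₀, orbitCoord β w 1 I₀ ≠ 0 ∧
      ∀ g ∈ unipotentMonoid τ 𝔪, orbitCoord β w g I₀ = orbitCoord β w 1 I₀ := by
  classical
  obtain ⟨I, hI⟩ := exists_plucker_ne_zero β hw
  -- A nonzero coordinate of least weight cannot receive contributions from below.
  obtain ⟨I₀, hI₀, hmin⟩ := Finset.exists_min_image
    (Finset.univ.filter fun I => orbitCoord β w 1 I ≠ 0) (multiWeight wt)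
    ⟨I, Finset.mem_filter.2 ⟨Finset.mem_univ _, hI⟩⟩
  refine ⟨I₀, (Finset.mem_filter.1 hI₀).2, fun g hg => ?_⟩
  have h1 := orbitCoord_mul (β := β) w g 1 I₀
  rw [mul_one, H.sum_tensorMatrix_mul hg] at h1
  · exact h1
  · intro J hJ
    by_contra hne
    exact (hmin J (Finset.mem_filter.2 ⟨Finset.mem_univ _, hne⟩)).not_gt hJ

/-- If the coordinates do not move, `exp (t τ x)` preserves the subspace; differentiate and use that
it normalizes itself. Conversely, an operator preserving the subspace scales all coordinates by one
factor, and the nonzero invariant coordinate forces this factor to be `1`. -/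
theorem infinitesimalStabilizer_univ {w : Fin d → V} (hw : LinearIndependent ℂ w)
    (hself : ∀ x ∈ 𝔪, (∀ v ∈ Submodule.span ℂ (Set.range w),
      τ x v ∈ Submodule.span ℂ (Set.range w)) ↔ x ∈ Submodule.span ℂ (Set.range w)) :
    infinitesimalStabilizer τ 𝔪 β w Finset.univ = 𝔪 ⊓ Submodule.span ℂ (Set.range w) := by
  set W := Submodule.span ℂ (Set.range w) with hW
  ext x
  refine ⟨fun hx => ?_, fun ⟨hxm, hxW⟩ => ?_⟩
  · obtain ⟨hxm, hxI⟩ := mem_infinitesimalStabilizer.1 hx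
    refine ⟨hxm, (hself x hxm).1 fun v hv => ?_⟩
    have h1 : ∀ t : ℂ, NormedSpace.exp (t • τ x) v ∈ W := fun t => by
      have h2 := span_eq_of_orbitCoord_eq (β := β) hw (exp_smul_mem_unipotentMonoid hxm t)
        (Submonoid.one_mem (unipotentMonoid τ 𝔪)) fun I => by
          rw [orbitCoord_exp H (fun J _ => Finset.mem_univ J) hx (hxI I (Finset.mem_univ I)),
            mul_zero, add_zero]
      have h3 : W.map ((NormedSpace.exp (t • τ x) : V →L[ℂ] V) : V →ₗ[ℂ] V) = W :=
        (map_span_range _ w).trans h2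
      exact h3.le (Submodule.mem_map_of_mem hv)
    by_contra hcon
    obtain ⟨η, hη, hηW⟩ := Submodule.exists_le_ker_of_notMem hcon
    have h2 : HasDerivAt (fun t : ℂ => NormedSpace.exp (t • τ x) v) (τ x v) 0 := by
      have := (ContinuousLinearMap.apply ℂ V v).hasFDerivAt.comp_hasDerivAt (0 : ℂ)
        (hasDerivAt_exp_smul (τ x) 0)
      simpa [Function.comp_def] using this
    have h3 := η.toContinuousLinearMap.hasFDerivAt.comp_hasDerivAt (0 : ℂ) h2
    have h4 : (η.toContinuousLinearMap ∘ fun t : ℂ => NormedSpace.exp (t • τ x) v) =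
        fun _ => (0 : ℂ) := funext fun t => hηW (h1 t)
    rw [h4] at h3
    exact hη (h3.unique (hasDerivAt_const _ _))
  · refine mem_infinitesimalStabilizer.2 ⟨hxm, fun I _ => ?_⟩
    obtain ⟨I₀, hI₀, hinv⟩ := exists_invariant_coord H hw
    have h1 : ∀ t : ℂ, orbitCoord β w (NormedSpace.exp (t • τ x)) I = orbitCoord β w 1 I := by
      intro t
      obtain ⟨c, hc⟩ := exists_wedgePairing_eq_mul
        (w := fun b => NormedSpace.exp (t • τ x) (w b)) (w' := w) fun b =>
          exp_apply_mem (W := W)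
            (fun v hv => W.smul_mem t ((hself x hxm).2 hxW v hv)) (Submodule.subset_span ⟨b, rfl⟩)
      have h2 : orbitCoord β w 1 I₀ = c * orbitCoord β w 1 I₀ :=
        (hinv _ (exp_smul_mem_unipotentMonoid hxm t)).symm.trans (hc _)
      have h3 : c = 1 := by
        field_simp at h2
        exact h2.symm
      exact (hc _).trans (by rw [h3, one_mul]; rfl)
    have h2 := hasDerivAt_orbitCoord (β := β) w I (hasDerivAt_exp_smul (τ x) 0)
    simp only [h1] at h2
    simpa using h2.unique (hasDerivAt_const _ _)

/-- Near the point with matrix `A₀`, the map `s` parametrizes the orbit of that point, and `ζ`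
extends the inverse of the parametrization. -/
structure IsSlice {J : Type*} [Fintype J] (τ : V →L[ℂ] V →L[ℂ] V) (𝔪 : Submodule ℂ V)
    (χ : Dual ℂ V) (e : Basis (Fin d ⊕ Fin m) ℂ V) (A₀ : GrCoord d m)
    (ζ : GrCoord d m → J → ℂ) (s : (J → ℂ) → V →L[ℂ] V) (q : (J → ℂ) → ℂ) : Prop where
  isPrimitive : IsPrimitive τ 𝔪 χ s q
  analyticAt : AnalyticAt ℂ ζ A₀
  one : s (ζ A₀) = 1
  eventually_section : ∀ᶠ z in 𝓝 (ζ A₀), ζ (grMatrix e fun b => s z (grFrame e A₀ b)) = z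
  mem_iff : ∀ᶠ A in 𝓝 A₀, grChart e A ∈ unipotentOrbit τ 𝔪 (grChart e A₀) ↔
    grChart e A = (grChart e A₀).map (s (ζ A) : V →ₗ[ℂ] V)
  card : Fintype.card J + finrank ℂ (𝔪 ⊓ grChart e A₀ : Submodule ℂ V) = finrank ℂ 𝔪

omit H in
theorem IsPrimitive.comp_linear {Z Z' : Type*} [NormedAddCommGroup Z] [NormedSpace ℂ Z]
    [NormedAddCommGroup Z'] [NormedSpace ℂ Z'] {s : Z → V →L[ℂ] V} {q : Z → ℂ}
    (hs : IsPrimitive τ 𝔪 χ s q) (T : Z' →L[ℂ] Z) :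
    IsPrimitive τ 𝔪 χ (fun z => s (T z)) (fun z => q (T z)) where
  mem z := hs.mem _
  analyticAt z := (hs.analyticAt (T z)).comp (T.analyticAt z)
  analyticAt_primitive z := (hs.analyticAt_primitive (T z)).comp (T.analyticAt z)
  exists_fderiv z v := by
    obtain ⟨a, ha, h1, h2⟩ := hs.exists_fderiv (T z) (T v)
    have h3 := (hs.analyticAt (T z)).differentiableAt.hasFDerivAt.comp z T.hasFDerivAt
    have h4 := (hs.analyticAt_primitive (T z)).differentiableAt.hasFDerivAt.comp z T.hasFDerivAt
    refine ⟨a, ha, ?_, ?_⟩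
    · rw [← h1]; exact congrArg (fun L : Z' →L[ℂ] V →L[ℂ] V => L v) h3.fderiv
    · rw [h2]; exact (congrArg (fun L : Z' →L[ℂ] ℂ => L v) h4.fderiv).symm

omit H [Fintype ι] in
theorem analyticAt_plucker_apply {X κ : Type*} [NormedAddCommGroup X] [NormedSpace ℂ X]
    (e : Basis κ ℂ V) (w : Fin d → V) (I : Fin d → κ) {s : X → V →L[ℂ] V} {x : X}
    (hs : AnalyticAt ℂ s x) : AnalyticAt ℂ (fun x => plucker e (fun b => s x (w b)) I) x :=
  analyticAt_wedgePairing _ fun b =>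
    ((ContinuousLinearMap.apply ℂ V (w b)).analyticAt _).comp hs

omit H [Fintype ι] in
theorem analyticAt_grMatrix {X : Type*} [NormedAddCommGroup X] [NormedSpace ℂ X]
    (e : Basis (Fin d ⊕ Fin m) ℂ V) (w : Fin d → V) {s : X → V →L[ℂ] V} {x : X}
    (hs : AnalyticAt ℂ s x) (hx : plucker e (fun b => s x (w b)) Sum.inl ≠ 0) :
    AnalyticAt ℂ (fun x => grMatrix e fun b => s x (w b)) x :=
  analyticAt_pi_iff.2 fun _ => analyticAt_pi_iff.2 fun _ =>
    (analyticAt_plucker_apply e w _ hs).div (analyticAt_plucker_apply e w _ hs) hx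

omit H [Fintype ι] in
theorem analyticAt_grFrame (e : Basis (Fin d ⊕ Fin m) ℂ V) (b : Fin d) (A : GrCoord d m) :
    AnalyticAt ℂ (fun A => grFrame e A b) A := by
  unfold grFrame
  refine analyticAt_const.add (Finset.analyticAt_fun_sum _ fun j _ => ?_)
  refine AnalyticAt.smul ?_ analyticAt_const
  exact ((ContinuousLinearMap.proj (R := ℂ) (φ := fun _ : Fin m => ℂ) j).comp
    (ContinuousLinearMap.proj (R := ℂ) (φ := fun _ : Fin d => Fin m → ℂ) b)).analyticAt A

/-- The section recovers every point of the orbit from its coordinates in `J`, however far along the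
group the point lies. No other sheet of the orbit can then accumulate at `A₀`, so the orbit is
embedded and not merely immersed. -/
theorem exists_isSlice (e : Basis (Fin d ⊕ Fin m) ℂ V) (A₀ : GrCoord d m)
    (hself : ∀ x ∈ 𝔪, (∀ v ∈ grChart e A₀, τ x v ∈ grChart e A₀) ↔ x ∈ grChart e A₀) :
    ∃ (J : Finset (Fin d → ι)) (ζ : GrCoord d m → J → ℂ) (s : (J → ℂ) → V →L[ℂ] V)
      (q : (J → ℂ) → ℂ), IsSlice τ 𝔪 χ e A₀ ζ s q := by
  classical
  set w := grFrame e A₀ with hw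
  have hli : LinearIndependent ℂ w := linearIndependent_grFrame e A₀
  obtain ⟨J, s, q, hs⟩ := exists_isOrbitSection H w
  obtain ⟨I₀, hI₀, hinv⟩ := exists_invariant_coord H hli
  -- extension of coordinates by zero
  let T : (J → ℂ) →L[ℂ] ((Fin d → ι) → ℂ) := LinearMap.toContinuousLinearMap
    (LinearMap.pi fun I => if h : I ∈ J then LinearMap.proj ⟨I, h⟩ else 0)
  have hT : ∀ (z : J → ℂ) (I : J), T z I = z I := fun z I => by
    simp [T]
  -- normalized Plücker coordinates
  let P : GrCoord d m → (Fin d → ι) → ℂ := fun A I =>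
    orbitCoord β w 1 I₀ / plucker β (grFrame e A) I₀ * plucker β (grFrame e A) I
  let ζ : GrCoord d m → J → ℂ := fun A I => P A I
  have hpl : ∀ I, plucker β (grFrame e A₀) I = orbitCoord β w 1 I := fun I => rfl
  have hPan : ∀ (I), AnalyticAt ℂ (fun A => plucker β (grFrame e A) I) A₀ := fun I =>
    analyticAt_wedgePairing _ fun b => analyticAt_grFrame e b A₀
  have hP₀ : P A₀ = orbitCoord β w 1 := by
    funext I
    simp only [P, hpl]
    rw [div_self hI₀, one_mul]
  have hU : ∀ᶠ A in 𝓝 A₀, plucker β (grFrame e A) I₀ ≠ 0 :=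
    (hPan I₀).continuousAt.eventually_ne hI₀
  -- the value of the normalized coordinates on the orbit
  have hPg : ∀ A g, plucker β (grFrame e A) I₀ ≠ 0 → g ∈ unipotentMonoid τ 𝔪 →
      grChart e A = (grChart e A₀).map (g : V →ₗ[ℂ] V) → P A = orbitCoord β w g := by
    intro A g hA hg hAg
    rw [grChart, grChart, map_span_range] at hAg
    obtain ⟨c, hc⟩ := exists_wedgePairing_eq_mul (w := grFrame e A) (w' := fun b => g (w b))
      fun b => by rw [← hAg]; exact Submodule.subset_span ⟨b, rfl⟩
    have hcI : ∀ I, plucker β (grFrame e A) I = c * orbitCoord β w g I := fun I => hc _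
    rw [hcI, hinv g hg] at hA
    have hc0 := left_ne_zero_of_mul hA
    funext I
    simp only [P, hcI, hinv g hg]
    field_simp
  have hsT : ∀ g ∈ unipotentMonoid τ 𝔪, s (T fun I : J => orbitCoord β w g I) =
      s (orbitCoord β w g) := fun g _ => hs.congr _ _ fun I hI => hT _ ⟨I, hI⟩
  have hone : s (T (ζ A₀)) = 1 := by
    have : ζ A₀ = fun I : J => orbitCoord β w 1 I := funext fun I => congrFun hP₀ I
    rw [this, hsT 1 (Submonoid.one_mem _), hs.one]
  refine ⟨J, ζ, fun z => s (T z), fun z => q (T z), hs.isPrimitive.comp_linear T, ?_, hone, ?_, ?_,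
    ?_⟩
  · refine analyticAt_pi_iff.2 fun I => ?_
    exact (analyticAt_const.div (hPan I₀) hI₀).mul (hPan I)
  · have h1 : AnalyticAt ℂ (fun z : J → ℂ => s (T z)) (ζ A₀) :=
      (hs.isPrimitive.comp_linear T).analyticAt _
    have h2 : plucker e (fun b => s (T (ζ A₀)) (w b)) Sum.inl ≠ 0 := by
      rw [hone]
      exact (plucker_grFrame_inl e A₀).trans_ne one_ne_zero
    have h3 := (analyticAt_grMatrix e w h1 h2).continuousAt
    have h4 : grMatrix e (fun b => s (T (ζ A₀)) (w b)) = A₀ := by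
      rw [hone]; exact grMatrix_grFrame e A₀
    rw [ContinuousAt, h4] at h3
    filter_upwards [(analyticAt_plucker_apply e w Sum.inl h1).continuousAt.eventually_ne h2,
      h3.eventually hU] with z hz1 hz2
    have h5 := hPg _ (s (T z)) hz2 (hs.isPrimitive.mem _)
      ((grChart_grMatrix e hz1).trans (map_span_range _ w).symm)
    funext I
    change P _ I = z I
    rw [h5, hs.coord _ I I.2, hT]
  · filter_upwards [hU] with A hA
    refine ⟨?_, fun h => ⟨_, hs.isPrimitive.mem _, h⟩⟩
    rintro ⟨g, hg, hAg⟩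
    have h1 : ζ A = fun I : J => orbitCoord β w g I :=
      funext fun I => congrFun (hPg A g hA hg hAg) I
    rw [h1, hsT g hg, hAg]
    rw [grChart, map_span_range, map_span_range]
    exact span_eq_of_orbitCoord_eq hli hg (hs.isPrimitive.mem _) fun I =>
      hs.surj g hg I (Finset.mem_univ I)
  · have h1 := hs.card
    rw [infinitesimalStabilizer_univ H hli hself] at h1
    rw [Fintype.card_coe]
    exact h1

end Slice

/-! ### Twisted conormal bundles of the orbits -/

section

variable {V : Type*} [AddCommGroup V] [Module ℂ V]

/-- The covectors on the points of `X` that vanish on the point and agree with `χ` on `𝔪`. -/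
def twistedConormal (𝔪 : Submodule ℂ V) (χ : Dual ℂ V) (X : Set (Submodule ℂ V)) :
    Set (Dual ℂ V × Submodule ℂ V) :=
  {y | y.2 ∈ X ∧ (∀ v ∈ y.2, y.1 v = 0) ∧ ∀ x ∈ 𝔪, y.1 x = χ x}

end

section Conormal

variable {V : Type*} [NormedAddCommGroup V] [NormedSpace ℂ V] [FiniteDimensional ℂ V]
  {ι : Type*} {d m : ℕ}
  {τ : V →L[ℂ] V →L[ℂ] V} {𝔪 W W' : Submodule ℂ V} {χ : Dual ℂ V} {β : Basis ι ℂ V}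
  {wt : ι → ℝ} {g : V →L[ℂ] V} {X : Set (Submodule ℂ V)}

theorem unipotentOrbit_subset (h : W' ∈ unipotentOrbit τ 𝔪 W) :
    unipotentOrbit τ 𝔪 W' ⊆ unipotentOrbit τ 𝔪 W := by
  obtain ⟨g, hg, rfl⟩ := h
  rintro _ ⟨g', hg', rfl⟩
  exact ⟨g' * g, Submonoid.mul_mem _ hg' hg, (Submodule.map_comp _ _ _).symm⟩

theorem mem_unipotentOrbit_symm (h : W' ∈ unipotentOrbit τ 𝔪 W) : W ∈ unipotentOrbit τ 𝔪 W' := by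
  obtain ⟨g, hg, rfl⟩ := h
  obtain ⟨g', hg', -, h⟩ := exists_inv_of_mem_unipotentMonoid hg
  refine ⟨g', hg', ?_⟩
  rw [← Submodule.map_comp]
  change W = W.map ((g' * g : V →L[ℂ] V) : V →ₗ[ℂ] V)
  rw [h]
  exact (Submodule.map_id W).symm

theorem unipotentOrbit_eq (h : W' ∈ unipotentOrbit τ 𝔪 W) :
    unipotentOrbit τ 𝔪 W' = unipotentOrbit τ 𝔪 W :=
  (unipotentOrbit_subset h).antisymm (unipotentOrbit_subset (mem_unipotentOrbit_symm h))

theorem injective_of_mem (hg : g ∈ unipotentMonoid τ 𝔪) : Function.Injective g := by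
  obtain ⟨g', -, -, h⟩ := exists_inv_of_mem_unipotentMonoid hg
  exact Function.LeftInverse.injective (g := g') fun v => congrArg (fun T : V →L[ℂ] V => T v) h

theorem finrank_inf_le_of_mem (H : IsUnipotentAction τ 𝔪 χ β wt)
    (h : W' ∈ unipotentOrbit τ 𝔪 W) :
    finrank ℂ (𝔪 ⊓ W : Submodule ℂ V) ≤ finrank ℂ (𝔪 ⊓ W' : Submodule ℂ V) := by
  obtain ⟨g, hg, rfl⟩ := h
  rw [(Submodule.equivMapOfInjective (g : V →ₗ[ℂ] V) (injective_of_mem hg)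
    (𝔪 ⊓ W : Submodule ℂ V)).finrank_eq]
  refine Submodule.finrank_mono ?_
  rintro _ ⟨v, hv, rfl⟩
  exact ⟨H.stable_of_mem hg hv.1, Submodule.mem_map_of_mem hv.2⟩

theorem finrank_inf_eq_of_mem (H : IsUnipotentAction τ 𝔪 χ β wt)
    (h : W' ∈ unipotentOrbit τ 𝔪 W) :
    finrank ℂ (𝔪 ⊓ W' : Submodule ℂ V) = finrank ℂ (𝔪 ⊓ W : Submodule ℂ V) :=
  (finrank_inf_le_of_mem H (mem_unipotentOrbit_symm h)).antisymm (finrank_inf_le_of_mem H h)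

theorem finrank_eq_of_mem (h : W' ∈ unipotentOrbit τ 𝔪 W) : finrank ℂ W' = finrank ℂ W := by
  obtain ⟨g, hg, rfl⟩ := h
  exact (Submodule.equivMapOfInjective (g : V →ₗ[ℂ] V) (injective_of_mem hg) W).finrank_eq.symm

/-- Transport by `g` moves the fibre over `g W` to the fixed affine space `l₀ + (W + 𝔪)^⊥`. The
condition on `𝔪` is preserved because `𝔪` and `χ|_𝔪` are. -/
theorem mem_twistedConormal_map (H : IsUnipotentAction τ 𝔪 χ β wt) {l₀ l : Dual ℂ V}
    (hl₀ : (l₀, W) ∈ twistedConormal 𝔪 χ X) (hg : g ∈ unipotentMonoid τ 𝔪) :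
    (l, W.map (g : V →ₗ[ℂ] V)) ∈ twistedConormal 𝔪 χ X ↔
      W.map (g : V →ₗ[ℂ] V) ∈ X ∧
        l.comp (g : V →ₗ[ℂ] V) - l₀ ∈ (W ⊔ 𝔪).dualAnnihilator := by
  obtain ⟨-, h1, h2⟩ := hl₀
  dsimp only at h1 h2
  obtain ⟨g', hg', hgg', -⟩ := exists_inv_of_mem_unipotentMonoid hg
  rw [Submodule.dualAnnihilator_sup_eq, Submodule.mem_inf, Submodule.mem_dualAnnihilator,
    Submodule.mem_dualAnnihilator]
  refine and_congr_right fun _ => and_congr ?_ ?_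
  · constructor
    · intro h v hv
      simpa [h1 v hv] using h (g v) (Submodule.mem_map_of_mem hv)
    · rintro h _ ⟨v, hv, rfl⟩
      simpa [h1 v hv] using h v hv
  · constructor
    · intro h x hx
      have := h (g x) (H.stable_of_mem hg hx)
      simp only [H.invariant_of_mem hg hx] at this
      simp [this, h2 x hx]
    · intro h x hx
      have h3 := h (g' x) (H.stable_of_mem hg' hx)
      have h4 : g (g' x) = x := congrArg (fun T : V →L[ℂ] V => T x) hgg'
      simp only [LinearMap.sub_apply, LinearMap.comp_apply, ContinuousLinearMap.coe_coe, h4,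
        h2 _ (H.stable_of_mem hg' hx), H.invariant_of_mem hg' hx] at h3
      exact sub_eq_zero.1 h3

namespace IsSlice

variable {J : Type*} [Fintype J] {e : Basis (Fin d ⊕ Fin m) ℂ V} {A₀ : GrCoord d m}
  {ζ : GrCoord d m → J → ℂ} {s : (J → ℂ) → V →L[ℂ] V} {q : (J → ℂ) → ℂ}
  (hs : IsSlice τ 𝔪 χ e A₀ ζ s q)
include hs

theorem plucker_ne_zero : plucker e (fun b => s (ζ A₀) (grFrame e A₀ b)) Sum.inl ≠ 0 := by
  rw [hs.one]
  exact (plucker_grFrame_inl e A₀).trans_ne one_ne_zero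

theorem grMatrix_eq : grMatrix e (fun b => s (ζ A₀) (grFrame e A₀ b)) = A₀ := by
  rw [hs.one]
  exact grMatrix_grFrame e A₀

theorem analyticAt_grMatrix :
    AnalyticAt ℂ (fun z => grMatrix e fun b => s z (grFrame e A₀ b)) (ζ A₀) :=
  SlodowyConormal.analyticAt_grMatrix e _ (hs.isPrimitive.analyticAt _) hs.plucker_ne_zero

theorem eventually_grChart_grMatrix :
    ∀ᶠ z in 𝓝 (ζ A₀), grChart e (grMatrix e fun b => s z (grFrame e A₀ b)) =
      (grChart e A₀).map (s z : V →ₗ[ℂ] V) := by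
  filter_upwards [(analyticAt_plucker_apply e (grFrame e A₀) Sum.inl
    (hs.isPrimitive.analyticAt (ζ A₀))).continuousAt.eventually_ne hs.plucker_ne_zero] with z hz
  exact (grChart_grMatrix e hz).trans (map_span_range _ _).symm

theorem eventually_mem_iff_grMatrix :
    ∀ᶠ A in 𝓝 A₀, grChart e A ∈ unipotentOrbit τ 𝔪 (grChart e A₀) ↔
      grMatrix e (fun b => s (ζ A) (grFrame e A₀ b)) = A := by
  filter_upwards [hs.mem_iff, hs.analyticAt.continuousAt.eventually hs.eventually_grChart_grMatrix]
    with A h1 h2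
  rw [h1, ← h2]
  exact ⟨fun h => (grChart_injective e h).symm, fun h => by rw [h]⟩

theorem mul_inverse (z : J → ℂ) : s z * Ring.inverse (s z) = 1 ∧ Ring.inverse (s z) * s z = 1 := by
  obtain ⟨g', -, h1, h2⟩ := exists_inv_of_mem_unipotentMonoid (hs.isPrimitive.mem z)
  have hu : IsUnit (s z) := ⟨⟨s z, g', h1, h2⟩, rfl⟩
  exact ⟨Ring.mul_inverse_cancel _ hu, Ring.inverse_mul_cancel _ hu⟩

theorem analyticAt_inverse (z : J → ℂ) : AnalyticAt ℂ (fun z => Ring.inverse (s z)) z := by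
  have := FiniteDimensional.complete ℂ V
  let u : (V →L[ℂ] V)ˣ := ⟨s z, Ring.inverse (s z), (hs.mul_inverse z).1, (hs.mul_inverse z).2⟩
  exact (_root_.analyticAt_inverse (𝕜 := ℂ) u).comp (f := s) (hs.isPrimitive.analyticAt z)

/-- The orbit is a submanifold near the base point of a slice. -/
theorem exists_orbit_chart :
    ∃ φ : OpenPartialHomeomorph (GrCoord d m) (GrCoord d m), A₀ ∈ φ.source ∧
      AnalyticOnNhd ℂ φ φ.source ∧ AnalyticOnNhd ℂ φ.symm φ.target ∧
      ∃ K : Submodule ℂ (GrCoord d m), finrank ℂ K = Fintype.card J ∧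
        ∀ A ∈ φ.source, A ∈ grChart e ⁻¹' unipotentOrbit τ 𝔪 (grChart e A₀) ↔ φ A ∈ K := by
  exact exists_submanifold_chart hs.analyticAt hs.analyticAt_grMatrix hs.grMatrix_eq
    (finrank_fintype_fun_eq_card ℂ) hs.eventually_section hs.eventually_mem_iff_grMatrix

end IsSlice

/-- The coordinates of the covector `l ∘ g`, where `c` are the coordinates of `l`. -/
def covectorComp (e : Basis (Fin d ⊕ Fin m) ℂ V) (c : Fin d ⊕ Fin m → ℂ) (g : V →L[ℂ] V) :
    Fin d ⊕ Fin m → ℂ :=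
  fun i => e.constr ℂ c (g (e i))

theorem constr_covectorComp (e : Basis (Fin d ⊕ Fin m) ℂ V) (c : Fin d ⊕ Fin m → ℂ)
    (g : V →L[ℂ] V) :
    e.constr ℂ (covectorComp e c g) = (e.constr ℂ c).comp (g : V →ₗ[ℂ] V) :=
  e.ext fun i => by simp [covectorComp]

theorem covectorComp_mul (e : Basis (Fin d ⊕ Fin m) ℂ V) (c : Fin d ⊕ Fin m → ℂ)
    (g g' : V →L[ℂ] V) : covectorComp e (covectorComp e c g) g' = covectorComp e c (g * g') := by
  funext i
  conv_lhs => rw [covectorComp, constr_covectorComp]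
  rfl

theorem covectorComp_one (e : Basis (Fin d ⊕ Fin m) ℂ V) (c : Fin d ⊕ Fin m → ℂ) :
    covectorComp e c 1 = c := by
  funext i
  simp [covectorComp]

theorem analyticAt_covectorComp {Y : Type*} [NormedAddCommGroup Y] [NormedSpace ℂ Y]
    (e : Basis (Fin d ⊕ Fin m) ℂ V) {c : Y → Fin d ⊕ Fin m → ℂ} {g : Y → V →L[ℂ] V} {y : Y}
    (hc : AnalyticAt ℂ c y) (hg : AnalyticAt ℂ g y) :
    AnalyticAt ℂ (fun y => covectorComp e (c y) (g y)) y := by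
  refine analyticAt_pi_iff.2 fun i => ?_
  simp only [covectorComp, Basis.constr_apply_fintype, smul_eq_mul]
  refine Finset.analyticAt_fun_sum _ fun j _ => ?_
  refine AnalyticAt.mul ?_ (analyticAt_pi_iff.1 hc j)
  exact ((e.coord j).toContinuousLinearMap.analyticAt _).comp
    (((ContinuousLinearMap.apply ℂ V (e i)).analyticAt _).comp hg)

/-- The conormal directions at `W`. -/
abbrev conormalSpace (𝔪 W : Submodule ℂ V) : Submodule ℂ (Dual ℂ V) := (W ⊔ 𝔪).dualAnnihilator

theorem finrank_conormalSpace_add (𝔪 W : Submodule ℂ V) :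
    finrank ℂ (conormalSpace 𝔪 W) + finrank ℂ W + finrank ℂ 𝔪 =
      finrank ℂ V + finrank ℂ (𝔪 ⊓ W : Submodule ℂ V) := by
  have h1 := Subspace.finrank_add_finrank_dualAnnihilator_eq (W ⊔ 𝔪)
  have h2 := Submodule.finrank_sup_add_finrank_inf_eq W 𝔪
  rw [inf_comm] at h2
  unfold conormalSpace
  omega

namespace IsSlice

variable {J : Type*} [Fintype J] {e : Basis (Fin d ⊕ Fin m) ℂ V} {A₀ : GrCoord d m}
  {ζ : GrCoord d m → J → ℂ} {s : (J → ℂ) → V →L[ℂ] V} {q : (J → ℂ) → ℂ}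

/-- The half-dimension count: base and fibre dimensions sum to `m` because the stabilizer is `𝔪 ∩
W`. -/
theorem card_add_finrank (hs : IsSlice τ 𝔪 χ e A₀ ζ s q) :
    Fintype.card J + finrank ℂ (conormalSpace 𝔪 (grChart e A₀)) = m := by
  have h1 := finrank_conormalSpace_add 𝔪 (grChart e A₀)
  have h2 := hs.card
  rw [finrank_grChart, finrank_eq_card_basis e, Fintype.card_sum, Fintype.card_fin,
    Fintype.card_fin] at h1
  omega

/-- The twisted conormal bundle is a submanifold near each point over the base point of a slice. -/
theorem exists_conormal_chart (H : IsUnipotentAction τ 𝔪 χ β wt)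
    (hs : IsSlice τ 𝔪 χ e A₀ ζ s q) {c₀ : Fin d ⊕ Fin m → ℂ}
    (hc₀ : pairChart e (c₀, A₀) ∈ twistedConormal 𝔪 χ (unipotentOrbit τ 𝔪 (grChart e A₀))) :
    ∃ φ : OpenPartialHomeomorph (PairCoord d m) (PairCoord d m), (c₀, A₀) ∈ φ.source ∧
      AnalyticOnNhd ℂ φ φ.source ∧ AnalyticOnNhd ℂ φ.symm φ.target ∧
      ∃ K : Submodule ℂ (PairCoord d m), finrank ℂ K = m ∧
        ∀ p ∈ φ.source, p ∈ pairChart e ⁻¹'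
          twistedConormal 𝔪 χ (unipotentOrbit τ 𝔪 (grChart e A₀)) ↔ φ p ∈ K := by
  set W := grChart e A₀ with hW
  set K := conormalSpace 𝔪 W with hK
  let κ := e.constr (M' := ℂ) ℂ
  let r := finrank ℂ K
  let bK : K ≃ₗ[ℂ] (Fin r → ℂ) := (finBasis ℂ K).equivFun
  -- A linear retraction onto `K` turns membership in `K` into a fixed point condition, as
  -- `exists_submanifold_chart` requires.
  obtain ⟨θ, hθ⟩ := LinearMap.exists_extend (bK : K →ₗ[ℂ] (Fin r → ℂ))
  let inc : (Fin r → ℂ) →ₗ[ℂ] Dual ℂ V := K.subtype.comp (bK.symm : (Fin r → ℂ) →ₗ[ℂ] K)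
  have hθinc : ∀ b, θ (inc b) = b := fun b => by
    have := LinearMap.congr_fun hθ (bK.symm b)
    simpa [inc] using this
  have hmemK : ∀ l, l ∈ K ↔ inc (θ l) = l := by
    refine fun l => ⟨fun hl => ?_, fun h => ?_⟩
    · have := LinearMap.congr_fun hθ ⟨l, hl⟩
      simp only [LinearMap.comp_apply, Submodule.subtype_apply, LinearEquiv.coe_coe] at this
      simp [inc, this]
    · rw [← h]; exact (bK.symm (θ l)).2
  let Θ : (Fin d ⊕ Fin m → ℂ) →L[ℂ] (Fin r → ℂ) :=
    LinearMap.toContinuousLinearMap (θ.comp (κ : (Fin d ⊕ Fin m → ℂ) →ₗ[ℂ] Dual ℂ V))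
  let Inc : (Fin r → ℂ) →L[ℂ] (Fin d ⊕ Fin m → ℂ) :=
    LinearMap.toContinuousLinearMap ((κ.symm : Dual ℂ V →ₗ[ℂ] (Fin d ⊕ Fin m → ℂ)).comp inc)
  have hΘInc : ∀ b, Θ (Inc b) = b := fun b => by simp [Θ, Inc, hθinc]
  have hmem : ∀ c, κ c ∈ K ↔ Inc (Θ c) = c := fun c => by
    rw [hmemK]
    refine ⟨fun h => ?_, fun h => ?_⟩
    · simp [Θ, Inc, h]
    · have := congrArg κ h
      simpa [Θ, Inc] using this
  -- The covector is carried back to the fibre over `A₀` by the section, and its deviation from `c₀`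
  -- is then recorded. `ΨL` undoes this.
  let ζL : PairCoord d m → (J → ℂ) × (Fin r → ℂ) := fun p =>
    (ζ p.2, Θ (covectorComp e p.1 (s (ζ p.2)) - c₀))
  let ΨL : (J → ℂ) × (Fin r → ℂ) → PairCoord d m := fun z =>
    (covectorComp e (c₀ + Inc z.2) (Ring.inverse (s z.1)),
      grMatrix e fun b => s z.1 (grFrame e A₀ b))
  have hζ₀ : ζL (c₀, A₀) = (ζ A₀, 0) := by
    simp [ζL, hs.one, covectorComp_one]
  have hζ1 : AnalyticAt ℂ (fun p : PairCoord d m => ζ p.2) (c₀, A₀) :=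
    AnalyticAt.comp (f := Prod.snd) (x := (c₀, A₀)) hs.analyticAt analyticAt_snd
  have hfin : finrank ℂ ((J → ℂ) × (Fin r → ℂ)) = m := by
    rw [finrank_prod, finrank_fintype_fun_eq_card, finrank_fintype_fun_eq_card, Fintype.card_fin]
    exact hs.card_add_finrank
  refine exists_submanifold_chart (ζ := ζL) (Ψ := ΨL) ?_ ?_ ?_ hfin ?_ ?_
  · refine hζ1.prod ?_
    refine (Θ.analyticAt _).comp (AnalyticAt.sub ?_ analyticAt_const)
    exact analyticAt_covectorComp e analyticAt_fst ((hs.isPrimitive.analyticAt _).comp hζ1)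
  · rw [hζ₀]
    refine AnalyticAt.prod ?_ ?_
    · refine analyticAt_covectorComp e ?_ ?_
      · exact analyticAt_const.add ((Inc.analyticAt _).comp analyticAt_snd)
      · exact AnalyticAt.comp (f := Prod.fst) (hs.analyticAt_inverse _) analyticAt_fst
    · exact AnalyticAt.comp (f := Prod.fst) (x := (ζ A₀, (0 : Fin r → ℂ))) hs.analyticAt_grMatrix
        analyticAt_fst
  · rw [hζ₀]
    refine Prod.ext ?_ hs.grMatrix_eq
    simp only [ΨL, hs.one, map_zero, add_zero, Ring.inverse_one, covectorComp_one]
  · rw [hζ₀]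
    filter_upwards [(continuous_fst.tendsto ((ζ A₀, 0) : (J → ℂ) × (Fin r → ℂ))).eventually
      hs.eventually_section] with z hz
    simp only [ζL, ΨL, hz, covectorComp_mul, (hs.mul_inverse z.1).2, covectorComp_one,
      add_sub_cancel_left, hΘInc]
  · filter_upwards [(continuous_snd.tendsto ((c₀, A₀) : PairCoord d m)).eventually
      (hs.eventually_mem_iff_grMatrix.and hs.mem_iff)] with p hp
    obtain ⟨h1, h2⟩ := hp
    have hiff : p ∈ pairChart e ⁻¹' twistedConormal 𝔪 χ (unipotentOrbit τ 𝔪 W) ↔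
        grChart e p.2 ∈ unipotentOrbit τ 𝔪 W ∧
          Inc (Θ (covectorComp e p.1 (s (ζ p.2)) - c₀)) =
            covectorComp e p.1 (s (ζ p.2)) - c₀ := by
      by_cases hX : grChart e p.2 ∈ unipotentOrbit τ 𝔪 W
      · have h3 := mem_twistedConormal_map H (l := e.constr ℂ p.1) hc₀
          (hs.isPrimitive.mem (ζ p.2))
        change _ ↔ (grChart e A₀).map _ ∈ _ ∧ _ ∈ K at h3
        rw [← h2.1 hX] at h3
        refine Iff.trans (b := (e.constr ℂ p.1, grChart e p.2) ∈
          twistedConormal 𝔪 χ (unipotentOrbit τ 𝔪 W)) Iff.rfl ?_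
        rw [h3, ← hmem]
        refine and_congr_right fun _ => ?_
        change _ - κ c₀ ∈ K ↔ _
        rw [map_sub, ← constr_covectorComp]
      · exact ⟨fun h => absurd h.1 hX, fun h => absurd h.1 hX⟩
    rw [hiff, h1]
    constructor
    · rintro ⟨h3, h4⟩
      refine Prod.ext ?_ h3
      simp only [ζL, ΨL, h4, add_sub_cancel, covectorComp_mul, (hs.mul_inverse _).1,
        covectorComp_one]
    · intro h3
      have h4 := congrArg Prod.fst h3
      refine ⟨congrArg Prod.snd h3, ?_⟩
      simp only [ζL, ΨL] at h4
      conv_rhs => rw [← h4]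
      rw [covectorComp_mul, (hs.mul_inverse _).2, covectorComp_one, add_sub_cancel_left]

/-- Over a neighbourhood of the base point of a slice, the twisted conormal bundle is a trivial affine
bundle. -/
theorem exists_affine_trivialization (H : IsUnipotentAction τ 𝔪 χ β wt)
    (hs : IsSlice τ 𝔪 χ e A₀ ζ s q) {l₀ : Dual ℂ V}
    (hl₀ : (l₀, grChart e A₀) ∈ twistedConormal 𝔪 χ (unipotentOrbit τ 𝔪 (grChart e A₀))) {r : ℕ}
    (hr : finrank ℂ (conormalSpace 𝔪 (grChart e A₀)) = r) :
    ∃ U ∈ 𝓝 A₀, ∃ (l' : GrCoord d m → Dual ℂ V) (l : Fin r → GrCoord d m → Dual ℂ V),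
      (∀ x, AnalyticOnNhd ℂ (fun A => l' A x) U) ∧
      (∀ i x, AnalyticOnNhd ℂ (fun A => l i A x) U) ∧
      ∀ A ∈ U, grChart e A ∈ unipotentOrbit τ 𝔪 (grChart e A₀) →
        LinearIndependent ℂ (fun i => l i A) ∧
        ∀ z : Dual ℂ V,
          (z, grChart e A) ∈ twistedConormal 𝔪 χ (unipotentOrbit τ 𝔪 (grChart e A₀)) ↔
            ∃ c : Fin r → ℂ, z = l' A + ∑ i, c i • l i A := by
  set W := grChart e A₀
  let b : Basis (Fin r) ℂ (conormalSpace 𝔪 W) := finBasisOfFinrankEq ℂ _ hr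
  let γ : GrCoord d m → V →ₗ[ℂ] V := fun A => (Ring.inverse (s (ζ A)) : V →L[ℂ] V)
  have han : ∀ (l : Dual ℂ V) (x : V) (A : GrCoord d m), AnalyticAt ℂ ζ A →
      AnalyticAt ℂ (fun A => (l.comp (γ A)) x) A := fun l x A hA =>
    (l.toContinuousLinearMap.analyticAt _).comp
      (((ContinuousLinearMap.apply ℂ V x).analyticAt _).comp
        (AnalyticAt.comp (g := fun z => Ring.inverse (s z)) (hs.analyticAt_inverse _) hA))
  refine ⟨{A | AnalyticAt ℂ ζ A ∧ _}, hs.analyticAt.eventually_analyticAt.and hs.mem_iff,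
    fun A => l₀.comp (γ A), fun i A => (b i : Dual ℂ V).comp (γ A),
    fun x A hA => han _ x A hA.1, fun i x A hA => han _ x A hA.1, ?_⟩
  rintro A ⟨-, hA⟩ hAX
  have h1 := hs.mul_inverse (ζ A)
  have hγ : ∀ v, γ A (s (ζ A) v) = v := fun v => congrArg (fun T : V →L[ℂ] V => T v) h1.2
  have hγ' : ∀ v, s (ζ A) (γ A v) = v := fun v => congrArg (fun T : V →L[ℂ] V => T v) h1.1
  constructor
  · have h2 : LinearIndependent ℂ fun i => (b i : Dual ℂ V) :=
      b.linearIndependent.map' (conormalSpace 𝔪 W).subtype (Submodule.ker_subtype _)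
    rw [Fintype.linearIndependent_iff] at h2 ⊢
    refine fun c hc => h2 c (LinearMap.ext fun v => ?_)
    have h3 := LinearMap.congr_fun hc (s (ζ A) v)
    simpa [hγ] using h3
  · intro z
    have h2 := mem_twistedConormal_map H (l := z) hl₀ (hs.isPrimitive.mem (ζ A))
    rw [← hA.1 hAX] at h2
    rw [h2, and_iff_right hAX]
    constructor
    · intro hz
      refine ⟨fun i => b.repr ⟨_, hz⟩ i, ?_⟩
      have h3 := congrArg Subtype.val (b.sum_repr ⟨_, hz⟩)
      simp only [Submodule.coe_sum, Submodule.coe_smul] at h3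
      ext v
      have h4 := LinearMap.congr_fun h3 (γ A v)
      simp only [LinearMap.sub_apply, LinearMap.comp_apply, ContinuousLinearMap.coe_coe, hγ',
        LinearMap.sum_apply, LinearMap.smul_apply] at h4
      simp only [smul_eq_mul] at h4
      simp only [LinearMap.add_apply, LinearMap.comp_apply, LinearMap.sum_apply,
        LinearMap.smul_apply, smul_eq_mul, h4, add_sub_cancel]
    · rintro ⟨c, rfl⟩
      have h3 : (l₀.comp (γ A) + ∑ i, c i • (b i : Dual ℂ V).comp (γ A)).comp
          (s (ζ A) : V →ₗ[ℂ] V) - l₀ = ((∑ i, c i • b i : conormalSpace 𝔪 W) : Dual ℂ V) := by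
        ext v
        simp [hγ]
      rw [h3]
      exact SetLike.coe_mem _

omit [FiniteDimensional ℂ V] in
theorem _root_.AnalyticAt.hasDerivAt_line {Y E : Type*} [NormedAddCommGroup Y] [NormedSpace ℂ Y]
    [NormedAddCommGroup E] [NormedSpace ℂ E] {f : Y → E} {y : Y} (hf : AnalyticAt ℂ f y) (v : Y) :
    HasDerivAt (fun t : ℂ => f (y + t • v)) (fderiv ℂ f y v) 0 := by
  have hline : HasDerivAt (fun t : ℂ => y + t • v) v 0 := by
    simpa using ((hasDerivAt_id (0 : ℂ)).smul_const v).const_add y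
  have h3 : HasFDerivAt f (fderiv ℂ f y) (y + (0 : ℂ) • v) := by
    rw [zero_smul, add_zero]; exact hf.differentiableAt.hasFDerivAt
  exact h3.comp_hasDerivAt 0 hline

/-- Tangent vectors of the orbit are generated by elements of `𝔪`, and the 1-form given by `χ` on
these is the differential of a function. -/
theorem eventually_exists_generator (hs : IsSlice τ 𝔪 χ e A₀ ζ s q) {Y : Type*}
    [NormedAddCommGroup Y] [NormedSpace ℂ Y] {A : Y → GrCoord d m} {y₀ : Y} (hA : AnalyticAt ℂ A y₀)
    (hA₀ : A y₀ = A₀)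
    (hAX : ∀ᶠ y in 𝓝 y₀, grChart e (A y) ∈ unipotentOrbit τ 𝔪 (grChart e A₀)) :
    AnalyticAt ℂ (fun y => q (ζ (A y))) y₀ ∧ ∀ᶠ y in 𝓝 y₀, ∀ v, ∃ a ∈ 𝔪,
      (∀ i, τ a (grFrame e (A y) i) - ∑ j, fderiv ℂ A y v i j • e (Sum.inr j) ∈
        grChart e (A y)) ∧ χ a = fderiv ℂ (fun y => q (ζ (A y))) y v := by
  subst hA₀
  set W := grChart e (A y₀) with hW
  have hζA : AnalyticAt ℂ (fun y => ζ (A y)) y₀ := hs.analyticAt.comp hA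
  refine ⟨(hs.isPrimitive.analyticAt_primitive _).comp hζA, ?_⟩
  have hmap : ∀ᶠ y in 𝓝 y₀, grChart e (A y) = W.map (s (ζ (A y)) : V →ₗ[ℂ] V) := by
    filter_upwards [hA.continuousAt.eventually hs.mem_iff, hAX] with y h1 h2
    exact h1.1 h2
  filter_upwards [hA.eventually_analyticAt, hζA.eventually_analyticAt, hmap.eventually_nhds]
    with y hAy hζy hy v
  have hline : HasDerivAt (fun t : ℂ => y + t • v) v 0 := by
    simpa using ((hasDerivAt_id (0 : ℂ)).smul_const v).const_add y
  have hline0 : y + (0 : ℂ) • v = y := by simp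
  obtain ⟨a, ha, h1, h2⟩ := hs.isPrimitive.exists_fderiv (ζ (A y))
    (fderiv ℂ (fun y => ζ (A y)) y v)
  have hsder : HasDerivAt (fun t : ℂ => s (ζ (A (y + t • v)))) (τ a * s (ζ (A y))) 0 := by
    have h3 : HasFDerivAt s (fderiv ℂ s (ζ (A y))) (ζ (A (y + (0 : ℂ) • v))) := by
      rw [hline0]; exact (hs.isPrimitive.analyticAt _).differentiableAt.hasFDerivAt
    rw [← h1]
    exact h3.comp_hasDerivAt 0 (hζy.hasDerivAt_line v)
  refine ⟨a, ha, fun i => ?_, ?_⟩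
  · -- the frame is the image under `s` of a curve in `W`
    have hframe : HasDerivAt (fun t : ℂ => grFrame e (A (y + t • v)) i)
        (∑ j, fderiv ℂ A y v i j • e (Sum.inr j)) 0 := by
      have h3 := hAy.hasDerivAt_line v
      refine HasDerivAt.const_add _ (HasDerivAt.fun_sum fun j _ => HasDerivAt.smul_const ?_ _)
      exact hasDerivAt_pi.1 (hasDerivAt_pi.1 h3 i) j
    have hinv := (AnalyticAt.comp (g := fun z => Ring.inverse (s z)) (hs.analyticAt_inverse _)
      hζy).hasDerivAt_line v
    let w : ℂ → V := fun t => Ring.inverse (s (ζ (A (y + t • v)))) (grFrame e (A (y + t • v)) i)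
    obtain ⟨w', hw⟩ : ∃ w', HasDerivAt w w' 0 := ⟨_, hinv.clm_apply hframe⟩
    have hsw : ∀ t : ℂ, s (ζ (A (y + t • v))) (w t) = grFrame e (A (y + t • v)) i := fun t =>
      congrArg (fun T : V →L[ℂ] V => T (grFrame e (A (y + t • v)) i)) (hs.mul_inverse _).1
    have hwW : ∀ᶠ t in 𝓝 (0 : ℂ), w t ∈ W := by
      have hc : Filter.Tendsto (fun t : ℂ => y + t • v) (𝓝 0) (𝓝 y) := by
        have := hline.continuousAt
        rwa [ContinuousAt, hline0] at this
      filter_upwards [hc.eventually hy] with t ht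
      have h3 : grFrame e (A (y + t • v)) i ∈ grChart e (A (y + t • v)) :=
        Submodule.subset_span ⟨i, rfl⟩
      rw [ht] at h3
      obtain ⟨u, hu, huw⟩ := h3
      have h4 : w t = u := by
        refine injective_of_mem (hs.isPrimitive.mem (ζ (A (y + t • v)))) ?_
        rw [hsw t]; exact huw.symm
      rwa [h4]
    have hw'W : w' ∈ W := by
      by_contra hcon
      obtain ⟨η, hη, hηW⟩ := Submodule.exists_le_ker_of_notMem hcon
      have h3 := η.toContinuousLinearMap.hasFDerivAt.comp_hasDerivAt (0 : ℂ) hw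
      have h4 : HasDerivAt (η.toContinuousLinearMap ∘ w) 0 0 :=
        (hasDerivAt_const (0 : ℂ) (0 : ℂ)).congr_of_eventuallyEq
          (hwW.mono fun t ht => hηW ht)
      exact hη (h3.unique h4)
    -- The product rule for `frame = s w` gives `frame' = τ a frame + s w'`; the last term lies in
    -- the moving subspace, as `w' ∈ W`.
    have h5 := (hsder.clm_apply hw).unique
      (hframe.congr_of_eventuallyEq (Filter.Eventually.of_forall hsw))
    have h6 := hsw 0
    rw [hline0] at h5 h6
    rw [← h5, mul_apply_eq_comp, h6, sub_add_cancel_left, hy.self_of_nhds]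
    exact Submodule.neg_mem _ (Submodule.mem_map_of_mem hw'W)
  · rw [h2]
    have h3 := (hs.isPrimitive.analyticAt_primitive (ζ (A y))).differentiableAt.hasFDerivAt.comp y
      hζy.differentiableAt.hasFDerivAt
    exact (congrArg (fun L : Y →L[ℂ] ℂ => L v) h3.fderiv).symm

end IsSlice

end Conormal

/-! ### Nilpotent Lie algebras of operators -/

section NilExp

variable {V : Type*} [AddCommGroup V] [Module ℂ V]

/-- The exponential of a nilpotent endomorphism, a finite sum. -/
def nilExp (b : Module.End ℂ V) : Module.End ℂ V :=
  ∑ n ∈ Finset.range (nilpotencyClass b), ((n.factorial : ℂ)⁻¹) • b ^ n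

/-- The group generated by the exponentials of the nilpotent endomorphisms `B x`, `x ∈ 𝔪`. -/
def nilExpGroup (B : V →ₗ[ℂ] Module.End ℂ V) (𝔪 : Submodule ℂ V) : Subgroup (V ≃ₗ[ℂ] V) :=
  Subgroup.closure {φ | ∃ x ∈ 𝔪, IsNilpotent (B x) ∧ (φ : V →ₗ[ℂ] V) = nilExp (B x)}

/-- The vectors whose coordinates of weight less than `c` vanish. -/
def weightFiltration {ι : Type*} (β : Basis ι ℂ V) (wt : ι → ℝ) (c : ℝ) : Submodule ℂ V :=
  ⨅ (i : ι) (_ : wt i < c), LinearMap.ker (β.coord i)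

theorem mem_weightFiltration {ι : Type*} {β : Basis ι ℂ V} {wt : ι → ℝ} {c : ℝ} {v : V} :
    v ∈ weightFiltration β wt c ↔ ∀ i, wt i < c → β.coord i v = 0 := by
  simp [weightFiltration, Submodule.mem_iInf]

/-- The bracket `B` and the subspace `𝔪` satisfy the Jacobi identity, `χ` is a character of the subalgebra
`𝔪`, and `𝔪` acts by operators that raise the weights by at least one. -/
structure IsNilpotentAction {ι : Type*} (B : V →ₗ[ℂ] Module.End ℂ V) (𝔪 : Submodule ℂ V)
    (χ : Dual ℂ V) (β : Basis ι ℂ V) (wt : ι → ℝ) : Prop where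
  jacobi : ∀ x y v, B (B x y) v = B x (B y v) - B y (B x v)
  closed : ∀ x ∈ 𝔪, ∀ y ∈ 𝔪, B x y ∈ 𝔪
  character : ∀ x ∈ 𝔪, ∀ y ∈ 𝔪, χ (B x y) = 0
  raises : ∀ x ∈ 𝔪, ∀ c, ∀ v ∈ weightFiltration β wt c, B x v ∈ weightFiltration β wt (c + 1)

variable {ι : Type*} {B : V →ₗ[ℂ] Module.End ℂ V} {𝔪 : Submodule ℂ V} {χ : Dual ℂ V}
  {β : Basis ι ℂ V} {wt : ι → ℝ}

/-- All weights lie in `[-C, C]` and each application raises the filtration by one, so more than `2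
* C` applications give zero. -/
theorem IsNilpotentAction.isNilpotent [Fintype ι] (H : IsNilpotentAction B 𝔪 χ β wt) {x : V}
    (hx : x ∈ 𝔪) : IsNilpotent (B x) := by
  obtain ⟨C, hC⟩ := (Set.finite_range fun i => |wt i|).bddAbove
  have hC' : ∀ i, |wt i| ≤ C := fun i => hC ⟨i, rfl⟩
  obtain ⟨N, hN⟩ := exists_nat_gt (2 * C)
  have h1 : ∀ (n : ℕ) (v : V), (B x ^ n) v ∈ weightFiltration β wt (-C + n) := by
    intro n v
    induction n with
    | zero =>
      refine mem_weightFiltration.2 fun i hi => ?_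
      have := (abs_le.1 (hC' i)).1
      simp only [Nat.cast_zero, add_zero] at hi
      linarith
    | succ n ih =>
      rw [pow_succ', Nat.cast_succ, ← add_assoc]
      exact H.raises x hx _ _ ih
  refine ⟨N, LinearMap.ext fun v => β.ext_elem fun i => ?_⟩
  have h2 := mem_weightFiltration.1 (h1 N v) i (by linarith [(abs_le.1 (hC' i)).2])
  simpa using h2

end NilExp

/-! ### Comparison of nilpotent and analytic exponentials -/

section Bridge

variable {V : Type*} [NormedAddCommGroup V] [NormedSpace ℂ V] [FiniteDimensional ℂ V]
  {ι : Type*} {τ : V →L[ℂ] V →L[ℂ] V} {B : V →ₗ[ℂ] Module.End ℂ V} {𝔪 W : Submodule ℂ V}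
  {χ : Dual ℂ V} {β : Basis ι ℂ V} {wt : ι → ℝ}

theorem apply_exp_eq {a : V →L[ℂ] V} (ha : ∀ v ∈ W, a v ∈ W) {η : Dual ℂ V}
    (hη : ∀ v ∈ W, η (a v) = 0) {v : V} (hv : v ∈ W) : η (NormedSpace.exp a v) = η v := by
  have h1 : ∀ t : ℂ, HasDerivAt (fun t : ℂ => η (NormedSpace.exp (t • a) v)) 0 t := by
    intro t
    have h2 := ((ContinuousLinearMap.apply ℂ V v).hasFDerivAt.comp_hasDerivAt t
      (hasDerivAt_exp_smul a t))
    have h3 := η.toContinuousLinearMap.hasFDerivAt.comp_hasDerivAt t h2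
    rw [commute_exp_smul] at h3
    have h4 : η (a (NormedSpace.exp (t • a) v)) = 0 :=
      hη _ (exp_apply_mem (fun u hu => W.smul_mem t (ha u hu)) hv)
    rw [← h4]
    exact h3
  have h5 := eq_add_mul_of_hasDerivAt_const h1 1
  simpa using h5

/-- `Ad (exp x) = exp (ad x)`: after multiplication by `exp (-(t • τ x))`, the Jacobi identity makes
the derivative in `t` of the right-hand side vanish, so it keeps its value `τ y` at `t = 0`. -/
theorem exp_mul_eq_of_jacobi (hτ : ∀ x y, τ (τ x y) = τ x * τ y - τ y * τ x) (x y : V) :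
    NormedSpace.exp (τ x) * τ y = τ (NormedSpace.exp (τ x) y) * NormedSpace.exp (τ x) := by
  have hneg : ∀ t : ℂ, HasDerivAt (fun t : ℂ => NormedSpace.exp (-(t • τ x)))
      (NormedSpace.exp (-(t • τ x)) * -τ x) t := fun t => by
    simpa only [smul_neg] using hasDerivAt_exp_smul (-τ x) t
  let f : ℂ → V →L[ℂ] V := fun t => NormedSpace.exp (-(t • τ x)) *
    (τ (NormedSpace.exp (t • τ x) y) * NormedSpace.exp (t • τ x))
  have hf : ∀ t, HasDerivAt f 0 t := by
    intro t
    have h1 := hasDerivAt_exp_smul (τ x) t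
    have h2 := (ContinuousLinearMap.apply ℂ V y).hasFDerivAt.comp_hasDerivAt t h1
    have h3 := τ.hasFDerivAt.comp_hasDerivAt t h2
    have h4 := (hneg t).mul (h3.mul h1)
    convert! h4 using 1
    simp only [commute_exp_smul, Function.comp_apply, Pi.mul_apply, ContinuousLinearMap.apply_apply,
      mul_apply_eq_comp, hτ]
    noncomm_ring
  have h5 := is_const_of_deriv_eq_zero (fun t => (hf t).differentiableAt)
    (fun t => (hf t).deriv) 1 0
  simp only [f, one_smul, zero_smul, neg_zero, NormedSpace.exp_zero, one_mul, mul_one,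
    one_apply_eq_self] at h5
  rw [← h5, ← mul_assoc, exp_mul_exp_neg, one_mul]

/-- Each property integrates its infinitesimal counterpart. For `triangular`, raising weights by one
kills all coordinates of weight at most `c` of `τ x v`. -/
theorem IsNilpotentAction.isUnipotentAction (H : IsNilpotentAction B 𝔪 χ β wt)
    (hτ : ∀ x v, τ x v = B x v) : IsUnipotentAction τ 𝔪 χ β wt where
  semiconj x _ y := exp_mul_eq_of_jacobi (fun x y => by
    ext v
    simp only [hτ, sub_apply, mul_apply_eq_comp, H.jacobi]) x y
  stable x hx y hy := exp_apply_mem (fun v hv => by rw [hτ]; exact H.closed x hx v hv) hy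
  invariant x hx y hy := apply_exp_eq (W := 𝔪)
    (fun v hv => by rw [hτ]; exact H.closed x hx v hv)
    (fun v hv => by rw [hτ]; exact H.character x hx v hv) hy
  triangular x hx c v hv i hi := by
    have h1 : ∀ v ∈ weightFiltration β wt c, ∀ i, wt i ≤ c → β.coord i (τ x v) = 0 :=
      fun v hv i hi => by
        rw [hτ]
        exact mem_weightFiltration.1 (H.raises x hx c v hv) i (by linarith)
    exact apply_exp_eq (W := weightFiltration β wt c)
      (fun v hv => mem_weightFiltration.2 fun i hi => h1 v hv i hi.le)
      (fun v hv => h1 v hv i hi) (mem_weightFiltration.2 hv)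

theorem exp_apply_eq_nilExp {a : V →L[ℂ] V} {b : Module.End ℂ V} (hab : ∀ v, a v = b v)
    (hb : IsNilpotent b) (v : V) : NormedSpace.exp a v = nilExp b v := by
  have hpow : ∀ n v, (a ^ n) v = (b ^ n) v := by
    intro n
    induction n with
    | zero => exact fun v => rfl
    | succ n ih =>
      intro v
      rw [pow_succ, pow_succ, mul_apply_eq_comp, Module.End.mul_apply, hab, ih]
  have h0 : ∀ n ∉ Finset.range (nilpotencyClass b), ((n.factorial : ℂ)⁻¹) • a ^ n = 0 := by
    intro n hn
    ext u
    have : b ^ n = 0 :=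
      pow_eq_zero_of_le (by simpa using hn) (pow_nilpotencyClass hb)
    simp [hpow, this]
  rw [NormedSpace.exp_eq_tsum ℂ]
  simp only
  rw [tsum_eq_sum h0, nilExp]
  simp [hpow]

theorem nilExpGroup_orbit_eq (hτ : ∀ x v, τ x v = B x v)
    (hnil : ∀ x ∈ 𝔪, IsNilpotent (B x)) :
    {W' | ∃ φ ∈ nilExpGroup B 𝔪, W' = W.map (φ : V →ₗ[ℂ] V)} = unipotentOrbit τ 𝔪 W := by
  have h1 : ∀ φ ∈ nilExpGroup B 𝔪, ∃ g ∈ unipotentMonoid τ 𝔪, (g : V →ₗ[ℂ] V) = φ := by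
    intro φ hφ
    unfold nilExpGroup at hφ
    induction hφ using Subgroup.closure_induction with
    | mem φ hφ =>
      obtain ⟨x, hx, hn, h⟩ := hφ
      refine ⟨_, exp_mem_unipotentMonoid hx, ?_⟩
      rw [h]
      exact LinearMap.ext (exp_apply_eq_nilExp (hτ x) hn)
    | one => exact ⟨1, Submonoid.one_mem _, rfl⟩
    | mul φ ψ _ _ h2 h3 =>
      obtain ⟨g, hg, h2⟩ := h2
      obtain ⟨g', hg', h3⟩ := h3
      refine ⟨g * g', Submonoid.mul_mem _ hg hg', LinearMap.ext fun v => ?_⟩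
      have h4 := LinearMap.congr_fun h2 (g' v)
      have h5 := LinearMap.congr_fun h3 v
      simp only [ContinuousLinearMap.coe_coe, LinearEquiv.coe_coe] at h4 h5 ⊢
      rw [mul_apply_eq_comp, h4, h5]; rfl
    | inv φ _ h2 =>
      obtain ⟨g, hg, h2⟩ := h2
      obtain ⟨g', hg', h3, -⟩ := exists_inv_of_mem_unipotentMonoid hg
      refine ⟨g', hg', LinearMap.ext fun v => ?_⟩
      have h4 := LinearMap.congr_fun h2 (g' v)
      have h5 : g (g' v) = v := congrArg (fun T : V →L[ℂ] V => T v) h3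
      simp only [ContinuousLinearMap.coe_coe, LinearEquiv.coe_coe, h5] at h4 ⊢
      conv_rhs => rw [h4]
      exact (φ.symm_apply_apply _).symm
  have h2 : ∀ g ∈ unipotentMonoid τ 𝔪, ∃ φ ∈ nilExpGroup B 𝔪, (φ : V →ₗ[ℂ] V) = g := by
    intro g hg
    unfold unipotentMonoid at hg
    induction hg using Submonoid.closure_induction with
    | mem g hg =>
      obtain ⟨x, hx, rfl⟩ := hg
      have h3 := exp_mul_exp_neg (τ x)
      have h4 := exp_mul_exp_neg (-τ x)
      rw [neg_neg] at h4
      let φ : V ≃ₗ[ℂ] V := LinearEquiv.ofLinearMap (NormedSpace.exp (τ x) : V →L[ℂ] V)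
        (NormedSpace.exp (-τ x) : V →L[ℂ] V)
        (LinearMap.ext fun v => congrArg (fun T : V →L[ℂ] V => T v) h3)
        (LinearMap.ext fun v => congrArg (fun T : V →L[ℂ] V => T v) h4)
      refine ⟨φ, Subgroup.subset_closure ⟨x, hx, hnil x hx, ?_⟩, rfl⟩
      exact LinearMap.ext (exp_apply_eq_nilExp (hτ x) (hnil x hx))
    | one => exact ⟨1, Subgroup.one_mem _, rfl⟩
    | mul g g' _ _ h2 h3 =>
      obtain ⟨φ, hφ, h2⟩ := h2
      obtain ⟨ψ, hψ, h3⟩ := h3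
      refine ⟨φ * ψ, Subgroup.mul_mem _ hφ hψ, LinearMap.ext fun v => ?_⟩
      have h4 := LinearMap.congr_fun h2 (ψ v)
      have h5 := LinearMap.congr_fun h3 v
      exact h4.trans (congrArg g h5)
  ext W'
  constructor
  · rintro ⟨φ, hφ, rfl⟩
    obtain ⟨g, hg, h⟩ := h1 φ hφ
    exact ⟨g, hg, by rw [h]⟩
  · rintro ⟨g, hg, rfl⟩
    obtain ⟨φ, hφ, h⟩ := h2 g hg
    exact ⟨φ, hφ, by rw [h]⟩

end Bridge

/-! ### The twisted conormal bundle of an orbit in the Grassmannian -/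

section Global

/-- The twisted conormal bundle over the orbit `X` of subspaces that normalize themselves: the parts of its
structure that only depend on the charts of the Grassmannian. -/
structure ConormalStructure {V : Type*} [AddCommGroup V] [Module ℂ V]
    (B : V →ₗ[ℂ] Module.End ℂ V) (𝔪 : Submodule ℂ V) (χ : Dual ℂ V)
    (X : Set (Submodule ℂ V)) : Prop where
  exists_isGrSubmanifold : ∃ k, IsGrSubmanifold k X
  isComplexSubmanifold : ∀ (d m : ℕ) (e : Basis (Fin d ⊕ Fin m) ℂ V),
    IsComplexSubmanifold m (pairChart e ⁻¹' twistedConormal 𝔪 χ X)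
  exists_affine_trivialization : ∃ r, ∀ (d m : ℕ) (e : Basis (Fin d ⊕ Fin m) ℂ V)
    (A₀ : GrCoord d m), grChart e A₀ ∈ X →
    ∃ U ∈ 𝓝 A₀, ∃ (l' : GrCoord d m → Dual ℂ V) (l : Fin r → GrCoord d m → Dual ℂ V),
      (∀ x, AnalyticOnNhd ℂ (fun A => l' A x) U) ∧
      (∀ i x, AnalyticOnNhd ℂ (fun A => l i A x) U) ∧
      ∀ A ∈ U, grChart e A ∈ X → LinearIndependent ℂ (fun i => l i A) ∧
        ∀ z : Dual ℂ V, (z, grChart e A) ∈ twistedConormal 𝔪 χ X ↔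
          ∃ c : Fin r → ℂ, z = l' A + ∑ i, c i • l i A
  exists_generator : ∀ (d m : ℕ) (e : Basis (Fin d ⊕ Fin m) ℂ V)
    (A : ℂ × ℂ → GrCoord d m), AnalyticAt ℂ A 0 → (∀ᶠ u in 𝓝 0, grChart e (A u) ∈ X) →
    ∃ G : ℂ × ℂ → ℂ, AnalyticAt ℂ G 0 ∧ ∀ᶠ u in 𝓝 0, ∀ v, ∃ a ∈ 𝔪,
      (∀ i, B a (grFrame e (A u) i) - ∑ j, fderiv ℂ A u v i j • e (Sum.inr j) ∈
        grChart e (A u)) ∧ χ a = fderiv ℂ G u v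

theorem conormalStructure_of_norm {V : Type*} [NormedAddCommGroup V] [NormedSpace ℂ V]
    [FiniteDimensional ℂ V] {ι : Type*} [Fintype ι] {B : V →ₗ[ℂ] Module.End ℂ V}
    {𝔪 : Submodule ℂ V} {χ : Dual ℂ V} {β : Basis ι ℂ V} {wt : ι → ℝ}
    (H : IsNilpotentAction B 𝔪 χ β wt) {W₀ : Submodule ℂ V} {X : Set (Submodule ℂ V)}
    (hX : X = {W' | ∃ φ ∈ nilExpGroup B 𝔪, W' = W₀.map (φ : V →ₗ[ℂ] V)})
    (hself : ∀ W ∈ X, ∀ x ∈ 𝔪, (∀ v ∈ W, B x v ∈ W) ↔ x ∈ W)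
    (hne : ∀ W ∈ X, ∃ l, (l, W) ∈ twistedConormal 𝔪 χ X) :
    ConormalStructure B 𝔪 χ X := by
  let τ : V →L[ℂ] V →L[ℂ] V := LinearMap.toContinuousLinearMap
    ((LinearMap.toContinuousLinearMap (E := V) (F' := V) (𝕜 := ℂ)).toLinearMap.comp B)
  have hτ : ∀ x v, τ x v = B x v := fun x v => rfl
  have HU := H.isUnipotentAction hτ
  rw [nilExpGroup_orbit_eq hτ fun x hx => H.isNilpotent hx] at hX
  have horb : ∀ W ∈ X, unipotentOrbit τ 𝔪 W = X := fun W hW => by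
    rw [hX] at hW ⊢
    exact unipotentOrbit_eq hW
  have hslice : ∀ {d m : ℕ} (e : Basis (Fin d ⊕ Fin m) ℂ V) (A₀ : GrCoord d m),
      grChart e A₀ ∈ X → _ := fun e A₀ h => exists_isSlice HU e A₀ (hself _ h)
  -- A single `k` and a single `r` must serve all points and charts, so the intersection with `𝔪`
  -- must have constant dimension along the orbit.
  have hrank : ∀ W ∈ X, finrank ℂ (𝔪 ⊓ W : Submodule ℂ V) =
      finrank ℂ (𝔪 ⊓ W₀ : Submodule ℂ V) := fun W hW => by
    rw [hX] at hW; exact finrank_inf_eq_of_mem HU hW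
  refine ⟨⟨finrank ℂ 𝔪 - finrank ℂ (𝔪 ⊓ W₀ : Submodule ℂ V), ?_⟩, ?_,
    ⟨finrank ℂ (conormalSpace 𝔪 W₀), ?_⟩, ?_⟩
  · intro d m e A₀ hA₀
    obtain ⟨J, ζ, s, q, hs⟩ := hslice e A₀ hA₀
    have h1 := hs.exists_orbit_chart
    have h2 := hs.card
    rw [hrank _ hA₀] at h2
    rw [horb _ hA₀, show Fintype.card J =
      finrank ℂ 𝔪 - finrank ℂ (𝔪 ⊓ W₀ : Submodule ℂ V) by omega] at h1
    exact h1
  · rintro d m e ⟨c₀, A₀⟩ h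
    have hA₀ : grChart e A₀ ∈ X := h.1
    obtain ⟨J, ζ, s, q, hs⟩ := hslice e A₀ hA₀
    have h1 := hs.exists_conormal_chart HU (c₀ := c₀) (by rwa [horb _ hA₀])
    rwa [horb _ hA₀] at h1
  · intro d m e A₀ hA₀
    obtain ⟨J, ζ, s, q, hs⟩ := hslice e A₀ hA₀
    obtain ⟨l, hl⟩ := hne _ hA₀
    have h2 := finrank_conormalSpace_add 𝔪 W₀
    have h3 := finrank_conormalSpace_add 𝔪 (grChart e A₀)
    have h4 : finrank ℂ (grChart e A₀) = finrank ℂ W₀ := by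
      rw [hX] at hA₀; exact finrank_eq_of_mem hA₀
    rw [hrank _ hA₀, h4] at h3
    have h1 := hs.exists_affine_trivialization HU (l₀ := l) (by rwa [horb _ hA₀])
      (r := finrank ℂ (conormalSpace 𝔪 W₀)) (by omega)
    rwa [horb _ hA₀] at h1
  · intro d m e A hA hAX
    have hA₀ := hAX.self_of_nhds
    obtain ⟨J, ζ, s, q, hs⟩ := hslice e (A 0) hA₀
    exact ⟨_, hs.eventually_exists_generator hA rfl (by rwa [horb _ hA₀])⟩

/-- The conclusion refers only to matrix coordinates and scalar functions, so any norm on `V` may be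
used in the proof; one is transported from `ℂⁿ`. -/
theorem IsNilpotentAction.conormalStructure {V : Type*} [AddCommGroup V] [Module ℂ V]
    [FiniteDimensional ℂ V] {ι : Type*} [Fintype ι] {B : V →ₗ[ℂ] Module.End ℂ V}
    {𝔪 : Submodule ℂ V} {χ : Dual ℂ V} {β : Basis ι ℂ V} {wt : ι → ℝ}
    (H : IsNilpotentAction B 𝔪 χ β wt) {W₀ : Submodule ℂ V} {X : Set (Submodule ℂ V)}
    (hX : X = {W' | ∃ φ ∈ nilExpGroup B 𝔪, W' = W₀.map (φ : V →ₗ[ℂ] V)})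
    (hself : ∀ W ∈ X, ∀ x ∈ 𝔪, (∀ v ∈ W, B x v ∈ W) ↔ x ∈ W)
    (hne : ∀ W ∈ X, ∃ l, (l, W) ∈ twistedConormal 𝔪 χ X) :
    ConormalStructure B 𝔪 χ X := by
  let b := (finBasis ℂ V).equivFun
  let _ : NormedAddCommGroup V := NormedAddCommGroup.induced V (Fin (finrank ℂ V) → ℂ) b b.injective
  let _ : NormedSpace ℂ V := NormedSpace.induced ℂ V (Fin (finrank ℂ V) → ℂ) b
  exact conormalStructure_of_norm H hX hself hne

end Global

/-! ### The nilpotent subalgebra attached to an `𝔰𝔩₂`-triple -/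

section Lie

variable {𝔤 : Type*} [LieRing 𝔤] [LieAlgebra ℂ 𝔤] {h e f : 𝔤} {ℓ : Submodule ℂ 𝔤}

variable (𝔤) in
/-- The adjoint representation as a linear map. -/
abbrev adLinear : 𝔤 →ₗ[ℂ] Module.End ℂ 𝔤 := 
  (LieAlgebra.ad ℂ 𝔤 : 𝔤 →ₗ[ℂ] Module.End ℂ 𝔤)

theorem mem_weightSpace {i : ℤ} {x : 𝔤} : x ∈ weightSpace h i ↔ ⁅h, x⁆ = (i : ℂ) • x := by
  rw [weightSpace, Module.End.mem_eigenspace_iff, LieAlgebra.ad_apply]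

theorem lie_mem_weightSpace {i j : ℤ} {x y : 𝔤} (hx : x ∈ weightSpace h i)
    (hy : y ∈ weightSpace h j) : ⁅x, y⁆ ∈ weightSpace h (i + j) := by
  rw [mem_weightSpace] at *
  rw [leibniz_lie, hx, hy, smul_lie, lie_smul, Int.cast_add, add_smul]

/-- Invariance of the Killing form, applied to `h`, gives `(i + 2) κ(e, x) = 0`. -/
theorem chi_apply_eq_zero (hef : IsSl2Triple h e f) {i : ℤ} (hi : i ≠ -2) {x : 𝔤}
    (hx : x ∈ weightSpace h i) : chi e x = 0 := by
  rw [mem_weightSpace] at hx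
  have h1 : killingForm ℂ 𝔤 ⁅e, h⁆ x = killingForm ℂ 𝔤 e ⁅h, x⁆ :=
    LieModule.traceForm_apply_lie_apply ℂ 𝔤 𝔤 e h x
  rw [hx, ← lie_skew, hef.lie_h_e_nsmul] at h1
  simp only [map_neg, map_nsmul, map_smul, LinearMap.neg_apply, LinearMap.smul_apply,
    smul_eq_mul, nsmul_eq_mul] at h1
  have h2 : ((i : ℂ) + 2) * killingForm ℂ 𝔤 e x = 0 := by
    push_cast at h1
    linear_combination -h1
  refine (mul_eq_zero.1 h2).resolve_left fun h3 => hi ?_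
  have : (i : ℂ) = ((-2 : ℤ) : ℂ) := by push_cast; linear_combination h3
  exact_mod_cast this

theorem weightSpace_le_mAlg {i : ℤ} (hi : i ≤ -2) : weightSpace h i ≤ mAlg h ℓ :=
  le_sup_of_le_right (le_iSup (fun i : {i : ℤ // i ≤ -2} => weightSpace h i) ⟨i, hi⟩)

/-- Brackets of total weight at most `-3` lie in `𝔪` and are killed by `χ`. The only remaining case
is `⁅ℓ, ℓ⁆`, of weight `-2`, where `χ` vanishes because `ℓ` is isotropic. -/
theorem lie_mem_mAlg (hef : IsSl2Triple h e f) (hℓ : IsLagrangianSubspace h e ℓ) {x y : 𝔤}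
    (hx : x ∈ mAlg h ℓ) (hy : y ∈ mAlg h ℓ) : ⁅x, y⁆ ∈ mAlg h ℓ ∧ chi e ⁅x, y⁆ = 0 := by
  have key : ∀ {i j : ℤ} {x y : 𝔤}, i + j ≤ -3 → x ∈ weightSpace h i → y ∈ weightSpace h j →
      ⁅x, y⁆ ∈ mAlg h ℓ ⊓ LinearMap.ker (chi e) := fun hij hx hy =>
    ⟨weightSpace_le_mAlg (by omega) (lie_mem_weightSpace hx hy),
      chi_apply_eq_zero hef (by omega) (lie_mem_weightSpace hx hy)⟩
  have h1 : Submodule.map₂ (adLinear 𝔤) (mAlg h ℓ) (mAlg h ℓ) ≤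
      mAlg h ℓ ⊓ LinearMap.ker (chi e) := by
    conv_lhs => rw [mAlg, Submodule.map₂_sup_left, Submodule.map₂_sup_right,
      Submodule.map₂_sup_right]
    simp only [Submodule.map₂_iSup_left, Submodule.map₂_iSup_right, sup_le_iff, iSup_le_iff,
      Submodule.map₂_le]
    refine ⟨⟨?_, ?_⟩, ?_, ?_⟩
    · intro x hx y hy
      exact ⟨weightSpace_le_mAlg (i := -1 + -1) (by norm_num) (lie_mem_weightSpace (hℓ.1 hx) (hℓ.1 hy)),
        (hℓ.2 x (hℓ.1 hx)).1 hx y hy⟩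
    · rintro ⟨j, hj⟩ x hx y hy
      exact key (by linarith) (hℓ.1 hx) hy
    · rintro ⟨j, hj⟩ x hx y hy
      exact key (by linarith) hx (hℓ.1 hy)
    · rintro ⟨i, hi⟩ ⟨j, hj⟩ x hx y hy
      exact key (by linarith) hx hy
  exact h1 (Submodule.apply_mem_map₂ (adLinear 𝔤) hx hy)

theorem mAlg_le (hℓ : IsLagrangianSubspace h e ℓ) :
    mAlg h ℓ ≤ ⨆ i : {i : ℤ // i ≤ -1}, weightSpace h i := by
  refine sup_le ?_ (iSup_le fun i => ?_)
  · exact hℓ.1.trans (le_iSup (fun i : {i : ℤ // i ≤ -1} => weightSpace h i) ⟨-1, le_rfl⟩)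
  · exact le_iSup (fun i : {i : ℤ // i ≤ -1} => weightSpace h i) ⟨i.1, by linarith [i.2]⟩

/-- A basis of generalized eigenvectors of `ad h`, with the negative real parts of the eigenvalues as
weights. -/
theorem exists_weight_basis [FiniteDimensional ℂ 𝔤] (h : 𝔤) :
    ∃ (ι : Type) (_ : Fintype ι) (β : Basis ι ℂ 𝔤) (wt : ι → ℝ),
      ∀ i : {i : ℤ // i ≤ -1}, ∀ x ∈ weightSpace h i, ∀ c, ∀ v ∈ weightFiltration β wt c,
        ⁅x, v⁆ ∈ weightFiltration β wt (c + 1) := by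
  classical
  let A : ℂ → Submodule ℂ 𝔤 := (LieAlgebra.ad ℂ 𝔤 h).maxGenEigenspace
  have hA : DirectSum.IsInternal A :=
    DirectSum.isInternal_submodule_of_iSupIndep_of_iSup_eq_top
      (Module.End.independent_maxGenEigenspace _) (Module.End.iSup_maxGenEigenspace_eq_top _)
  let v : ∀ μ, Basis (Fin (finrank ℂ (A μ))) ℂ (A μ) := fun μ => finBasis ℂ (A μ)
  let β := hA.collectedBasis v
  have hfin : Finite (Σ μ, Fin (finrank ℂ (A μ))) := Module.Finite.finite_basis β
  let hft : Fintype (Σ μ, Fin (finrank ℂ (A μ))) := Fintype.ofFinite _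
  refine ⟨_, hft, β, fun i => -i.1.re, ?_⟩
  rintro ⟨i, hi⟩ x hx c u hu
  rw [mem_weightFiltration] at hu ⊢
  intro k hk
  rw [← β.sum_repr u, lie_sum, map_sum]
  refine Finset.sum_eq_zero fun j _ => ?_
  rw [lie_smul, map_smul, smul_eq_mul]
  by_cases hj : -j.1.re < c
  · rw [← β.coord_apply, hu j hj, zero_mul]
  · have hx' : x ∈ A i := by
      have h1 : weightSpace h i ≤ A i := Module.End.eigenspace_le_maxGenEigenspace
      exact h1 hx
    have h2 : ⁅x, β j⁆ ∈ A (i + j.1) :=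
      LieModule.lie_mem_maxGenEigenspace_toEnd (M := 𝔤) (χ₁ := (i : ℂ)) (x := h) hx'
        (hA.collectedBasis_mem v j)
    have h3 : (i : ℂ) + j.1 ≠ k.1 := by
      intro h4
      have h5 := congrArg Complex.re h4
      have h6 : (i : ℝ) ≤ -1 := by exact_mod_cast hi
      simp only [Complex.add_re, Complex.intCast_re] at h5
      linarith
    have h7 : β.coord k ⁅x, β j⁆ = 0 := hA.collectedBasis_repr_of_mem_ne v h3 h2
    rw [h7, mul_zero]

theorem exists_isNilpotentAction [FiniteDimensional ℂ 𝔤] (hef : IsSl2Triple h e f)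
    (hℓ : IsLagrangianSubspace h e ℓ) :
    ∃ (ι : Type) (_ : Fintype ι) (β : Basis ι ℂ 𝔤) (wt : ι → ℝ),
      IsNilpotentAction (adLinear 𝔤) (mAlg h ℓ) (chi e) β wt := by
  obtain ⟨ι, hι, β, wt, hβ⟩ := exists_weight_basis h
  refine ⟨ι, hι, β, wt, fun x y v => ?_, fun x hx y hy => (lie_mem_mAlg hef hℓ hx hy).1,
    fun x hx y hy => (lie_mem_mAlg hef hℓ hx hy).2, fun x hx c v hv => ?_⟩
  · exact lie_lie x y v
  · replace hx := mAlg_le hℓ hx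
    induction hx using Submodule.iSup_induction' with
    | mem i x hxi => exact hβ i x hxi c v hv
    | zero => simp
    | add x y _ _ h1 h2 =>
      rw [map_add, LinearMap.add_apply]
      exact Submodule.add_mem _ h1 h2

/-! ### Functionals that vanish on a Borel subalgebra -/

/-- The annihilator of an intersection is the sum of the annihilators; the component of `χ` in `W^⊥`
is the required functional. -/
theorem exists_extension_iff [FiniteDimensional ℂ 𝔤] (χ : Dual ℂ 𝔤) (𝔪 W : Submodule ℂ 𝔤) :
    (∃ l : Dual ℂ 𝔤, (∀ x ∈ W, l x = 0) ∧ ∀ x ∈ 𝔪, l x = χ x) ↔ ∀ x ∈ 𝔪 ⊓ W, χ x = 0 := by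
  constructor
  · rintro ⟨l, h1, h2⟩ x hx
    rw [← h2 x hx.1, h1 x hx.2]
  · intro h1
    have h2 : χ ∈ (𝔪 ⊓ W).dualAnnihilator := (Submodule.mem_dualAnnihilator _).2 h1
    rw [Subspace.dualAnnihilator_inf_eq] at h2
    obtain ⟨μ, hμ, l, hl, rfl⟩ := Submodule.mem_sup.1 h2
    rw [Submodule.mem_dualAnnihilator] at hμ hl
    exact ⟨l, hl, fun x hx => by simp [hμ x hx]⟩

theorem mem_sigmaVariety_iff {y : Dual ℂ 𝔤 × Submodule ℂ 𝔤} :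
    y ∈ sigmaVariety h e ℓ ↔ y.2 ∈ flagVariety 𝔤 ∧ (∀ x ∈ y.2, y.1 x = 0) ∧
      ∀ x ∈ mAlg h ℓ, y.1 x = chi e x := by
  unfold sigmaVariety cotangentFlag
  rw [Set.mem_ofPred_eq, Set.mem_ofPred_eq, and_assoc]
  refine and_congr_right fun _ => and_congr_right fun _ => ⟨?_, fun h1 => ?_⟩
  · rintro ⟨μ, hμ, h1⟩ x hx
    simp [h1, hμ x hx]
  · exact ⟨y.1 - chi e, fun x hx => by simp [h1 x hx], by simp⟩

theorem mem_sigmaImage_iff [FiniteDimensional ℂ 𝔤] {W : Submodule ℂ 𝔤}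
    (hW : W ∈ flagVariety 𝔤) :
    W ∈ sigmaImage h e ℓ ↔ ∀ x ∈ mAlg h ℓ ⊓ W, chi e x = 0 := by
  rw [← exists_extension_iff]
  constructor
  · rintro ⟨y, hy, rfl⟩
    exact ⟨y.1, (mem_sigmaVariety_iff.1 hy).2⟩
  · rintro ⟨l, hl⟩
    exact ⟨(l, W), mem_sigmaVariety_iff.2 ⟨hW, hl⟩, rfl⟩

theorem sigmaImage_subset_flagVariety : sigmaImage h e ℓ ⊆ flagVariety 𝔤 := by
  rintro _ ⟨y, hy, rfl⟩
  exact (mem_sigmaVariety_iff.1 hy).1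

theorem sigmaPreimage_eq_twistedConormal {X : Set (Submodule ℂ 𝔤)} (hX : X ⊆ flagVariety 𝔤) :
    sigmaPreimage h e ℓ X = twistedConormal (mAlg h ℓ) (chi e) X := by
  ext y
  constructor
  · rintro ⟨hy, hyX⟩
    exact ⟨hyX, (mem_sigmaVariety_iff.1 hy).2⟩
  · rintro ⟨hyX, hy⟩
    exact ⟨mem_sigmaVariety_iff.2 ⟨hX hyX, hy⟩, hyX⟩

/-- A 1-form that is exact on `L` has vanishing exterior derivative there. -/
theorem isIsotropic_of_exists_generator {𝔪 : Submodule ℂ 𝔤} {χ : Dual ℂ 𝔤}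
    {X : Set (Submodule ℂ 𝔤)} (hX : X ⊆ flagVariety 𝔤)
    (H : ConormalStructure (adLinear 𝔤) 𝔪 χ X) : IsIsotropic (twistedConormal 𝔪 χ X) := by
  intro d m b F hF hL
  have hFA : AnalyticAt ℂ (fun u => (F u).2) 0 := AnalyticAt.comp (g := Prod.snd) analyticAt_snd hF
  obtain ⟨G, hG, hev⟩ := H.exists_generator d m b _ hFA (hL.mono fun u hu => hu.1)
  -- A generator `a ∈ 𝔪` of the tangent vector computes the Liouville form as `l a = χ a`, which is
  -- the differential of `G`. Isotropy then reduces to the symmetry of the second derivative of `G`.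
  have hθ : ∀ v, (fun u => liouvilleForm b (F u) (fderiv ℂ F u v)) =ᶠ[𝓝 0]
      fun u => fderiv ℂ G u v := by
    intro v
    filter_upwards [hev, hL, hF.eventually_analyticAt] with u h1 h2 h3
    obtain ⟨a, ha, h4, h5⟩ := h1 v
    have h6 : fderiv ℂ (fun u => (F u).2) u v = (fderiv ℂ F u v).2 := by
      rw [h3.differentiableAt.hasFDerivAt.snd.fderiv]; rfl
    rw [h6] at h4
    rw [liouvilleForm_eq b (F u) _ ⟨hX h2.1, h2.2.1⟩ (a := a) h4, ← h5]
    exact h2.2.2 a ha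
  have hGd : HasFDerivAt (fderiv ℂ G) (fderiv ℂ (fderiv ℂ G) 0) 0 :=
    hG.fderiv.differentiableAt.hasFDerivAt
  have hd : ∀ v, HasFDerivAt (fun u => liouvilleForm b (F u) (fderiv ℂ F u v))
      ((ContinuousLinearMap.apply ℂ ℂ v).comp (fderiv ℂ (fderiv ℂ G) 0)) 0 := fun v =>
    (((ContinuousLinearMap.apply ℂ ℂ v).hasFDerivAt.comp 0 hGd).congr_of_eventuallyEq (hθ v))
  refine ⟨_, _, hd (1, 0), hd (0, 1), ?_⟩
  have hsymm : IsSymmSndFDerivAt ℂ G 0 :=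
    ContDiffAt.isSymmSndFDerivAt_of_omega hG.contDiffAt
  simp only [ContinuousLinearMap.comp_apply, ContinuousLinearMap.apply_apply]
  rw [hsymm (1, 0) (0, 1), sub_self]

/-- The preimage of an orbit in the image of `σ` is a twisted conormal bundle. -/
theorem isTwistedConormalBundle_sigmaPreimage [FiniteDimensional ℂ 𝔤] (hef : IsSl2Triple h e f)
    (hℓ : IsLagrangianSubspace h e ℓ) {X : Set (Submodule ℂ 𝔤)}
    (hX : IsFlagOrbit (unipotentGroup (mAlg h ℓ)) X) (hXσ : X ⊆ sigmaImage h e ℓ) :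
    IsTwistedConormalBundle (sigmaPreimage h e ℓ X) X := by
  obtain ⟨W₀, -, hX⟩ := hX
  have hXB : X ⊆ flagVariety 𝔤 := hXσ.trans sigmaImage_subset_flagVariety
  obtain ⟨ι, _, β, wt, H⟩ := exists_isNilpotentAction hef hℓ
  -- The only place where it matters that the subspaces are Borel subalgebras for the structure of
  -- the orbit: they are their own normalizers.
  have hself : ∀ W ∈ X, ∀ x ∈ mAlg h ℓ, (∀ v ∈ W, adLinear 𝔤 x v ∈ W) ↔ x ∈ W := by
    intro W hW x _
    obtain ⟨b, hb, rfl⟩ := hXB hW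
    exact ⟨fun hx => hb.mem_of_normalizes hx, fun hx v hv => b.lie_mem hx hv⟩
  have hne : ∀ W ∈ X, ∃ l, (l, W) ∈ twistedConormal (mAlg h ℓ) (chi e) X := by
    intro W hW
    obtain ⟨l, hl⟩ := (exists_extension_iff _ _ _).2 ((mem_sigmaImage_iff (hXB hW)).1 (hXσ hW))
    exact ⟨l, hW, hl⟩
  have HX : ConormalStructure (adLinear 𝔤) (mAlg h ℓ) (chi e) X :=
    H.conormalStructure (W₀ := W₀) hX hself hne
  rw [sigmaPreimage_eq_twistedConormal hXB]
  exact ⟨⟨hXB, HX.exists_isGrSubmanifold⟩, fun y hy => hy.1,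
    ⟨fun y hy => ⟨hXB hy.1, hy.2.1⟩, HX.isComplexSubmanifold,
      isIsotropic_of_exists_generator hXB HX⟩, HX.exists_affine_trivialization⟩

end Lie

end SlodowyConormal

end

theorem proposition2p4 {𝔤 : Type*} [LieRing 𝔤] [LieAlgebra ℂ 𝔤] [FiniteDimensional ℂ 𝔤]
    [LieAlgebra.IsSemisimple ℂ 𝔤] (h e f : 𝔤) (hef : IsSl2Triple h e f)
    (ℓ : Submodule ℂ 𝔤) (hℓ : SlodowyConormal.IsLagrangianSubspace h e ℓ) :
    (∀ b : LieSubalgebra ℂ 𝔤, SlodowyConormal.IsBorel b →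
      (b.toSubmodule ∈ SlodowyConormal.sigmaImage h e ℓ ↔
        ∀ x ∈ SlodowyConormal.mAlg h ℓ ⊓ b.toSubmodule, SlodowyConormal.chi e x = 0)) ∧
    (∀ X : Set (Submodule ℂ 𝔤),
      SlodowyConormal.IsFlagOrbit
        (SlodowyConormal.unipotentGroup (SlodowyConormal.mAlg h ℓ)) X →
      X ⊆ SlodowyConormal.sigmaImage h e ℓ →
      SlodowyConormal.IsTwistedConormalBundle (SlodowyConormal.sigmaPreimage h e ℓ X) X) := by
  exact ⟨fun b hb => SlodowyConormal.mem_sigmaImage_iff ⟨b, hb, rfl⟩,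
    fun _ hX hXσ => SlodowyConormal.isTwistedConormalBundle_sigmaPreimage hef hℓ hX hXσ⟩
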